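/- **Conventions.** A signature $\sigma$ is a finite set of relation symbols, each with an arity in $\mathbb N$ (arity $0$ allowed); a $\sigma$-structure $\mathcal A$ has a finite universe $A$ and a relation $R(\mathcal A)\subseteq A^{\mathrm{ar}(R)}$ for each $R\in\sigma$. The Gaifman graph of $\mathcal A$ joins $a\ne b$ if they occur together in a tuple of some relation of $\mathcal A$; the degree of $\mathcal A$ is its maximum degree, and $\mathrm{dist}^{\mathcal A}$ is its graph distance. For tuples $\bar a$ (or several tuples), $N_r^{\mathcal A}(\bar a)$ is the set of elements at distance at most $r$ from some entry of $\bar a$ (empty if $\bar a$ is the empty tuple), and $\mathcal N_r^{\mathcal A}(\bar a)$ is the substructure of $\mathcal A$ induced on it. Fix a collection of numerical predicates (finitely many names $\mathsf P$, each with an arity $\ge1$ and a semantics $[\![\mathsf P]\!]\subseteq\mathbb Z^{\mathrm{ar}(\mathsf P)}$). $\mathrm{FOC}_1[\sigma]$ has formulas $x=y$, $R(\bar x)$, $\neg\phi$, $(\phi\lor\psi)$, $\exists x\,\phi$, and $\mathsf P(t_1,\dots,t_n)$ for terms $t_i$ that together have at most one free variable, and terms $\#\bar z.\phi$ (the number of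 tuples $\bar z$, of pairwise distinct variables, satisfying $\phi$), integers $i\in\mathbb Z$, $(t_1+t_2)$, $(t_1\cdot t_2)$. $\mathrm{FO}[\sigma]$ is the fragment without numerical predicates and terms. The size of an expression is its length as a string, integers and variables having length $1$; $\mathrm{FOC}_1[\sigma,n,q]$ is the set of $\mathrm{FOC}_1[\sigma]$-expressions with at most $n$ free variables and size at most $q$. Writing $\phi(\bar x)$ means that the free variables of $\phi$ are among $\bar x$. A formula $\phi(\bar x)$ is $r$-local (around $\bar x$) if $\mathcal A\models\phi[\bar a]\iff\mathcal N_r^{\mathcal A}(\bar a)\models\phi[\bar a]$ for all $\sigma$-structures $\mathcal A$ and all tuples $\bar a$ in $A$. Graphs are finite, undirected and simple. For a graph $G$ on $[n]=\{1,\dots,n\}$ and a tuple $\bar x=(x_1,\dots,x_n)$ of pairwise distinct variables, $\delta^\sigma_{G,r}(\bar x)$ is the $\mathrm{FO}[\sigma]$-formula $$\bigwedge_{\{i,j\}\in E(G)}\mathrm{dist}^\sigma(x_i,x_j)\le r\ \land\bigwedge_{\{i,j\}\notin E(G),\ i\ne j}\neg\,\mathrm{dist}^\sigma(x_i,x_j)\le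 r ,$$ where $\mathrm{dist}^\sigma(x,y)\le r$ is a fixed $\mathrm{FO}[\sigma]$-formula expressing that the Gaifman distance is at most $r$. Let $\nu_d(r)=1+d\sum_{0\le i<r}(d-1)^i$. For $N\subseteq A$ and $\bar w,\bar w'\in A^\ell$ write $\bar w=_N\bar w'$ if $w_i=w'_i$ for all $i\in[\ell]$ with $w_i\in N$. **Lemma.** Let $\sigma'$ be a signature and $r',k,\ell,m\in\mathbb N$ with $k+\ell+m\ge1$. Let $\phi'(\bar x,\bar y,\bar z)$ be an $r'$-local $\mathrm{FO}[\sigma']$-formula, where $\bar x,\bar y,\bar z$ are tuples of lengths $k,\ell,m$ of variables, all of them pairwise distinct. Let $G$ be a graph with vertex set $[k+\ell+m]$, and let $$u_G(\bar x,\bar y):=\#\bar z.\bigl(\phi'(\bar x,\bar y,\bar z)\land\delta^{\sigma'}_{G,2r'+1}(\bar x,\bar y,\bar z)\bigr).$$ There is a number $q_G\in\mathbb N$ such that for every $\sigma'$-structure $\mathcal A'$ with universe $A$ and degree $d$, all $s\ge1$, all $\bar v_1,\dots,\bar v_s\in A^k$ and all $\bar w\in A^\ell$ there is an $\mathrm{FOC}_1[\sigma',k+\ell,q_G]$-term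 $u'_G(\bar x,\bar y)$ with the following properties, where $N:=N^{\mathcal A'}_{(2r'+1)(\ell+m)}(\bar v_1,\dots,\bar v_s)$. 1. For all $\bar w'\in A^\ell$ with $\bar w=_N\bar w'$ and all $i\in[s]$, $$(u_G)^{\mathcal A'}[\bar v_i,\bar w]=(u'_G)^{\mathcal A'}[\bar v_i,\bar w'].$$ 2. $u'_G$ is a combination, via addition and multiplication, of integers $i$ with $-1\le i\le\bigl(\ell\cdot\nu_d((2r'+1)m)\bigr)^m$ and of counting terms of the form $\#\bar z'.(\psi\land\delta^{\sigma'}_{H,2r'+1})(\bar u,\bar z')$ with $|\bar z'|\le m$, where $\bar u$ is a tuple of variables from $\bar x,\bar y$, the variables of $(\bar u,\bar z')$ are pairwise distinct, $H$ is a connected graph with vertex set $[|\bar u|+|\bar z'|]$, and $\psi(\bar u,\bar z')$ is an $\mathrm{FO}[\sigma']$-formula that is $r'$-local around $(\bar u,\bar z')$. -/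

import Mathlib

namespace FOC1

/-- A numerical predicate collection: finitely many predicate names, each with an arity `≥ 1` and
a semantics `⊆ ℤ ^ arity`. -/
structure NumPredicates where
  Name : Type
  finite_name : Finite Name
  arity : Name → ℕ
  arity_pos : ∀ p, 1 ≤ arity p
  sem : ∀ p, Set (Fin (arity p) → ℤ)

/-! ### Syntax. The set of variables is `ℕ`. A signature is a relational `FirstOrder.Language`
with finitely many relation symbols. -/

mutual
/-- Formulas. The restriction of rule `pred` that is specific to `FOC₁` is `Formula.IsFOC1`. -/
inductive Formula (L : FirstOrder.Language.{0, 0}) (P : NumPredicates) : Type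
  | eq (x y : ℕ) : Formula L P
  | rel {n : ℕ} (R : L.Relations n) (x : Fin n → ℕ) : Formula L P
  | neg (φ : Formula L P) : Formula L P
  | or (φ ψ : Formula L P) : Formula L P
  | ex (x : ℕ) (φ : Formula L P) : Formula L P
  | pred (p : P.Name) (t : Fin (P.arity p) → Term L P) : Formula L P
/-- Counting terms; `count x φ` is `#(x₁, …, xₙ).φ` for pairwise distinct variables `xᵢ`. -/
inductive Term (L : FirstOrder.Language.{0, 0}) (P : NumPredicates) : Type
  | count {n : ℕ} (x : Fin n ↪ ℕ) (φ : Formula L P) : Term L P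
  | int (i : ℤ) : Term L P
  | add (t₁ t₂ : Term L P) : Term L P
  | mul (t₁ t₂ : Term L P) : Term L P
end

variable {L : FirstOrder.Language.{0, 0}} {P : NumPredicates}

mutual
/-- Free variables of a formula. -/
def Formula.free : Formula L P → Finset ℕ
  | .eq x y => {x, y}
  | .rel _ x => Finset.univ.image x
  | .neg φ => φ.free
  | .or φ ψ => φ.free ∪ ψ.free
  | .ex x φ => φ.free \ {x}
  | .pred _ t => Finset.univ.biUnion fun i => (t i).free
/-- Free variables of a counting term. -/
def Term.free : Term L P → Finset ℕ
  | .count x φ => φ.free \ Finset.univ.image x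
  | .int _ => ∅
  | .add t₁ t₂ => t₁.free ∪ t₂.free
  | .mul t₁ t₂ => t₁.free ∪ t₂.free
end

mutual
/-- `φ` is an `FOC₁` formula: the arguments of each numerical predicate have together at most
one free variable. -/
def Formula.IsFOC1 : Formula L P → Prop
  | .eq _ _ => True
  | .rel _ _ => True
  | .neg φ => φ.IsFOC1
  | .or φ ψ => φ.IsFOC1 ∧ ψ.IsFOC1
  | .ex _ φ => φ.IsFOC1
  | .pred _ t => (∀ i, (t i).IsFOC1) ∧ (Finset.univ.biUnion fun i => (t i).free).card ≤ 1
/-- `t` is an `FOC₁` counting term. -/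
def Term.IsFOC1 : Term L P → Prop
  | .count _ φ => φ.IsFOC1
  | .int _ => True
  | .add t₁ t₂ => t₁.IsFOC1 ∧ t₂.IsFOC1
  | .mul t₁ t₂ => t₁.IsFOC1 ∧ t₂.IsFOC1
end

mutual
/-- Length of the formula as a string, integers and variables having length one:
`x=y`, `R(x,…,x)`, `¬φ`, `(φ∨ψ)`, `∃xφ`, `P(t,…,t)`. -/
def Formula.size : Formula L P → ℕ
  | .eq _ _ => 3
  | .rel (n := n) _ _ => 3 + n + (n - 1)
  | .neg φ => 1 + φ.size
  | .or φ ψ => 3 + φ.size + ψ.size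
  | .ex _ φ => 2 + φ.size
  | .pred p t => 3 + (∑ i, (t i).size) + (P.arity p - 1)
/-- Length of the term as a string: `#(x,…,x).φ`, `i`, `(t+t)`, `(t·t)`. -/
def Term.size : Term L P → ℕ
  | .count (n := n) _ φ => 4 + n + (n - 1) + φ.size
  | .int _ => 1
  | .add t₁ t₂ => 3 + t₁.size + t₂.size
  | .mul t₁ t₂ => 3 + t₁.size + t₂.size
end

/-- First-order formulas: those built without numerical predicates and counting terms. -/
inductive Formula.IsFO : Formula L P → Prop
  | eq (x y : ℕ) : IsFO (.eq x y)
  | rel {n : ℕ} (R : L.Relations n) (x : Fin n → ℕ) : IsFO (.rel R x)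
  | neg {φ : Formula L P} : IsFO φ → IsFO (.neg φ)
  | or {φ ψ : Formula L P} : IsFO φ → IsFO ψ → IsFO (.or φ ψ)
  | ex (x : ℕ) {φ : Formula L P} : IsFO φ → IsFO (.ex x φ)

/-- The set `FOC₁[σ, m, q]` of terms of size at most `q` with at most `m` free variables. -/
def Term.InFOC1 (m q : ℕ) (t : Term L P) : Prop :=
  t.IsFOC1 ∧ t.free.card ≤ m ∧ t.size ≤ q

/-! ### Semantics -/

mutual
/-- `(A, β) ⊨ φ`. -/
noncomputable def Formula.Realize {A : Type} [L.Structure A] : Formula L P → (ℕ → A) → Prop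
  | .eq x y, β => β x = β y
  | .rel R x, β => FirstOrder.Language.Structure.RelMap R (fun i => β (x i))
  | .neg φ, β => ¬ φ.Realize β
  | .or φ ψ, β => φ.Realize β ∨ ψ.Realize β
  | .ex x φ, β => ∃ a : A, φ.Realize (Function.update β x a)
  | .pred p t, β => (fun i => (t i).eval β) ∈ P.sem p
/-- The value of a term in `(A, β)`; `Function.extend x a β` is `β` with `xᵢ` reset to `aᵢ`. -/
noncomputable def Term.eval {A : Type} [L.Structure A] : Term L P → (ℕ → A) → ℤ
  | .count (n := n) x φ, β => (Nat.card {a : Fin n → A // φ.Realize (Function.extend x a β)} : ℤ)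
  | .int i, _ => i
  | .add t₁ t₂, β => t₁.eval β + t₂.eval β
  | .mul t₁ t₂, β => t₁.eval β * t₂.eval β
end

/-- `A ⊨ φ[a]` for a formula `φ(x)`: `(A, β) ⊨ φ` for all `β` with `β(xᵢ) = aᵢ`. -/
def Models (A : Type) [L.Structure A] {n : ℕ} (φ : Formula L P) (x : Fin n → ℕ) (a : Fin n → A) :
    Prop :=
  ∀ β : ℕ → A, (∀ i, β (x i) = a i) → φ.Realize β

/-! ### Gaifman graph, balls, locality -/

/-- The Gaifman graph of a structure. -/
def gaifman (L : FirstOrder.Language.{0, 0}) (A : Type) [L.Structure A] : SimpleGraph A where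
  Adj v w := v ≠ w ∧ ∃ (n : ℕ) (R : L.Relations n) (a : Fin n → A),
    FirstOrder.Language.Structure.RelMap R a ∧ v ∈ Set.range a ∧ w ∈ Set.range a
  symm := ⟨fun _ _ ⟨h, n, R, a, hR, hv, hw⟩ => ⟨h.symm, n, R, a, hR, hw, hv⟩⟩
  loopless := ⟨fun _ h => h.1 rfl⟩

/-- The degree of a (finite) structure: the maximum degree of its Gaifman graph. -/
noncomputable def degree (L : FirstOrder.Language.{0, 0}) (A : Type) [L.Structure A] : ℕ :=
  ⨆ v : A, ((gaifman L A).neighborSet v).ncard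

/-- The ball of radius `r` around the family `a`: the elements at distance `≤ r` from some `aᵢ`. -/
def ball (L : FirstOrder.Language.{0, 0}) {A : Type} [L.Structure A] {ι : Type} (r : ℕ) (a : ι → A) : Set A :=
  {b | ∃ i, (gaifman L A).edist (a i) b ≤ r}

theorem mem_ball (L : FirstOrder.Language.{0, 0}) {A : Type} [L.Structure A] {ι : Type} (r : ℕ)
    (a : ι → A)
    (i : ι) : a i ∈ ball L r a :=
  ⟨i, by simp⟩

/-- The induced substructure on a set of elements (for a relational language). -/
@[reducible] def induced (L : FirstOrder.Language.{0, 0}) [L.IsRelational] {A : Type} [L.Structure A]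
    (X : Set A) : L.Structure X where
  funMap f := isEmptyElim f
  RelMap R a := FirstOrder.Language.Structure.RelMap R (fun i => (a i : A))

/-- `φ(x)` is `r`-local around `x`: for every finite structure `A` and every tuple `a`,
`A ⊨ φ[a]` iff `φ[a]` holds in the `r`-neighbourhood of `a`, the induced substructure on the
`r`-ball around `a`. -/
def IsLocal [L.IsRelational] {n : ℕ} (r : ℕ) (φ : Formula L P) (x : Fin n → ℕ) : Prop :=
  (φ.free : Set ℕ) ⊆ Set.range x ∧
  ∀ (A : Type) [Finite A] [L.Structure A] (a : Fin n → A),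
    Models A φ x a ↔
      letI := induced L (ball L r a)
      Models (ball L r a) φ x (fun i => ⟨a i, mem_ball L r a i⟩)

/-! ### Distance formulas -/

/-- `(φ ∧ ψ)` abbreviates `¬(¬φ ∨ ¬ψ)`. -/
def Formula.and (φ ψ : Formula L P) : Formula L P := .neg (.or (.neg φ) (.neg ψ))

/-- A valid sentence, the empty conjunction. -/
def Formula.verum : Formula L P := .ex 0 (.eq 0 0)

def Formula.bigAnd (l : List (Formula L P)) : Formula L P := l.foldr Formula.and .verum

def Formula.bigOr (l : List (Formula L P)) : Formula L P := l.foldr Formula.or (.neg .verum)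

def Formula.exMany (l : List ℕ) (φ : Formula L P) : Formula L P := l.foldr Formula.ex φ

/-- `x` and `y` are adjacent in the Gaifman graph; the variables `x + y + 1 + i` are fresh. -/
noncomputable def Formula.adj [Finite (Σ n, L.Relations n)] (x y : ℕ) : Formula L P :=
  letI : Fintype (Σ n, L.Relations n) := Fintype.ofFinite _
  .and (.neg (.eq x y)) <| .bigOr <|
    (Finset.univ : Finset (Σ n, L.Relations n)).toList.flatMap fun R =>
      (List.finRange R.1 ×ˢ List.finRange R.1).map fun ij =>
        .exMany ((List.range R.1).map fun i => x + y + 1 + i) <|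
          .and (.rel R.2 fun i => x + y + 1 + (i : ℕ))
            (.and (.eq (x + y + 1 + (ij.1 : ℕ)) x) (.eq (x + y + 1 + (ij.2 : ℕ)) y))

/-- The first-order formula `dist(x, y) ≤ r`. -/
noncomputable def Formula.distLE [Finite (Σ n, L.Relations n)] : ℕ → ℕ → ℕ → Formula L P
  | 0, x, y => .eq x y
  | r + 1, x, y => .or (Formula.distLE r x y)
      (.ex (x + y + 1) (.and (Formula.distLE r x (x + y + 1)) (.adj (x + y + 1) y)))

open Classical in
/-- The formula `δ_{G,r}(x)`: for `i ≠ j`, `dist(xᵢ, xⱼ) ≤ r` if `{i,j}` is an edge of `G`, and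
`dist(xᵢ, xⱼ) > r` otherwise. -/
noncomputable def Formula.delta [Finite (Σ n, L.Relations n)] {n : ℕ} (G : SimpleGraph (Fin n))
    (r : ℕ) (x : Fin n → ℕ) : Formula L P :=
  let pairs := (List.finRange n ×ˢ List.finRange n).filter fun ij => ij.1 < ij.2
  .and
    (.bigAnd ((pairs.filter fun ij => G.Adj ij.1 ij.2).map fun ij => .distLE r (x ij.1) (x ij.2)))
    (.bigAnd ((pairs.filter fun ij => ¬ G.Adj ij.1 ij.2).map fun ij =>
      .neg (.distLE r (x ij.1) (x ij.2))))

/-! ### The distance formulas define what they should -/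

section

variable {A : Type} [L.Structure A]

theorem realize_and (φ ψ : Formula L P) (β : ℕ → A) :
    (φ.and ψ).Realize β ↔ φ.Realize β ∧ ψ.Realize β := by
  simp only [Formula.and, Formula.Realize]; tauto

theorem realize_verum (β : ℕ → A) : (Formula.verum : Formula L P).Realize β := by
  simp only [Formula.verum, Formula.Realize]; exact ⟨β 0, trivial⟩

theorem realize_bigAnd (l : List (Formula L P)) (β : ℕ → A) :
    (Formula.bigAnd l).Realize β ↔ ∀ φ ∈ l, φ.Realize β := by
  induction l with
  | nil => simpa [Formula.bigAnd] using realize_verum β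
  | cons a l ih => simp_all [Formula.bigAnd, realize_and]

theorem realize_bigOr (l : List (Formula L P)) (β : ℕ → A) :
    (Formula.bigOr l).Realize β ↔ ∃ φ ∈ l, φ.Realize β := by
  induction l with
  | nil => simpa [Formula.bigOr, Formula.Realize] using realize_verum β
  | cons a l ih => simp_all [Formula.bigOr, Formula.Realize]

theorem realize_exMany (l : List ℕ) (φ : Formula L P) (β : ℕ → A) :
    (Formula.exMany l φ).Realize β ↔ ∃ γ : ℕ → A, (∀ i ∉ l, γ i = β i) ∧ φ.Realize γ := by
  induction l generalizing β with
  | nil =>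
    simp only [Formula.exMany, List.foldr_nil]
    constructor
    · exact fun h => ⟨β, by simp, h⟩
    · rintro ⟨γ, h, h'⟩
      have : γ = β := by funext i; exact h i (by simp)
      exact this ▸ h'
  | cons a l ih =>
    simp only [Formula.exMany, List.foldr_cons, Formula.Realize] at ih ⊢
    simp only [ih]
    constructor
    · rintro ⟨b, γ, h, h'⟩
      refine ⟨γ, fun i hi => ?_, h'⟩
      simp only [List.mem_cons, not_or] at hi
      rw [h i hi.2, Function.update_of_ne hi.1]
    · rintro ⟨γ, h, h'⟩
      refine ⟨γ a, γ, fun i hi => ?_, h'⟩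
      by_cases hia : i = a
      · subst hia; simp
      · rw [Function.update_of_ne hia]; exact h i (by simp [hia, hi])

theorem realize_adj [Finite (Σ n, L.Relations n)] (x y : ℕ) (β : ℕ → A) :
    (Formula.adj x y : Formula L P).Realize β ↔ (gaifman L A).Adj (β x) (β y) := by
  simp only [Formula.adj, realize_and, realize_bigOr, Formula.Realize, gaifman]
  refine and_congr_right fun _ => ?_
  constructor
  · rintro ⟨φ, hφ, h⟩
    simp only [List.mem_flatMap, List.mem_map] at hφ
    obtain ⟨⟨n, R⟩, -, ij, -, rfl⟩ := hφ
    rw [realize_exMany] at h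
    obtain ⟨γ, hγ, h⟩ := h
    simp only [realize_and, Formula.Realize] at h
    have e : ∀ t, t ≤ x + y → γ t = β t := fun t ht => hγ t (by
      simp only [List.mem_map, not_exists, not_and]; intros; omega)
    refine ⟨n, R, _, h.1, ⟨ij.1, ?_⟩, ⟨ij.2, ?_⟩⟩
    · simpa [e x (by omega)] using h.2.1
    · simpa [e y (by omega)] using h.2.2
  · rintro ⟨n, R, a, hR, ⟨i, hi⟩, ⟨j, hj⟩⟩
    refine ⟨_, List.mem_flatMap.2 ⟨⟨n, R⟩, by simp, List.mem_map.2 ⟨(i, j), by simp, rfl⟩⟩, ?_⟩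
    rw [realize_exMany]
    let γ : ℕ → A := fun t => if h : x + y + 1 ≤ t ∧ t - (x + y + 1) < n then
      a ⟨t - (x + y + 1), h.2⟩ else β t
    have g : ∀ i : Fin n, γ (x + y + 1 + i) = a i := fun i => by
      simp only [γ]
      rw [dif_pos ⟨by omega, by omega⟩]
      congr 1; ext; simp
    have e : ∀ t, t ≤ x + y → γ t = β t := fun t ht => by
      simp only [γ]; rw [dif_neg (by omega)]
    refine ⟨γ, fun t ht => ?_, ?_⟩
    · simp only [γ]
      rw [dif_neg]
      rintro ⟨h1, h2⟩
      exact ht (List.mem_map.2 ⟨t - (x+y+1), by simpa using h2, by omega⟩)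
    · simp only [realize_and, Formula.Realize, g, e x (by omega), e y (by omega)]
      exact ⟨hR, hi, hj⟩

theorem edist_succ {V : Type} (G : SimpleGraph V) (r : ℕ) (a b : V) :
    G.edist a b ≤ (r + 1 : ℕ) ↔ G.edist a b ≤ r ∨ ∃ c, G.edist a c ≤ r ∧ G.Adj c b := by
  constructor
  · intro h
    by_cases h' : G.edist a b ≤ r
    · exact .inl h'
    right
    obtain ⟨p, hp⟩ := SimpleGraph.exists_walk_of_edist_ne_top (G := G) (u := a) (v := b)
      (ne_top_of_le_ne_top (by simp) h)
    have hl : p.length = r + 1 := by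
      rw [← hp] at h h'; simp only [Nat.cast_le] at h h'; omega
    have hn : ¬ p.Nil := by rw [← SimpleGraph.Walk.length_eq_zero_iff]; omega
    refine ⟨p.penultimate, ?_, p.adj_penultimate hn⟩
    refine (SimpleGraph.Walk.edist_le p.dropLast).trans ?_
    simp [hl]
  · rintro (h | ⟨c, h, h'⟩)
    · exact h.trans (by simp)
    · refine (SimpleGraph.edist_triangle (v := c)).trans ?_
      push_cast
      exact add_le_add h (SimpleGraph.edist_eq_one_iff_adj.2 h').le

theorem realize_distLE [Finite (Σ n, L.Relations n)] (r x y : ℕ) (β : ℕ → A) :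
    (Formula.distLE r x y : Formula L P).Realize β ↔ (gaifman L A).edist (β x) (β y) ≤ r := by
  induction r generalizing x y β with
  | zero => simp [Formula.distLE, Formula.Realize]
  | succ r ih =>
    have e1 : x ≠ x + y + 1 := by omega
    have e2 : y ≠ x + y + 1 := by omega
    simp only [Formula.distLE, Formula.Realize, realize_and, ih, realize_adj, edist_succ,
      Function.update_self, Function.update_of_ne e1, Function.update_of_ne e2]

theorem realize_delta [Finite (Σ n, L.Relations n)] {n : ℕ} (G : SimpleGraph (Fin n)) (r : ℕ)
    (x : Fin n → ℕ) (β : ℕ → A) :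
    (Formula.delta G r x : Formula L P).Realize β ↔
      ∀ i j, i ≠ j → (G.Adj i j ↔ (gaifman L A).edist (β (x i)) (β (x j)) ≤ r) := by
  simp only [Formula.delta, realize_and, realize_bigAnd, List.forall_mem_map, List.mem_filter,
    Formula.Realize, realize_distLE, decide_eq_true_eq]
  constructor
  · rintro ⟨h1, h2⟩ i j hij
    rcases lt_or_gt_of_ne hij with h | h
    · refine ⟨fun hG => h1 (i, j) ⟨⟨by simp, h⟩, hG⟩, fun hd => ?_⟩
      by_contra hG
      exact h2 (i, j) ⟨⟨by simp, h⟩, hG⟩ hd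
    · rw [G.adj_comm, SimpleGraph.edist_comm]
      refine ⟨fun hG => h1 (j, i) ⟨⟨by simp, h⟩, hG⟩, fun hd => ?_⟩
      by_contra hG
      exact h2 (j, i) ⟨⟨by simp, h⟩, hG⟩ hd
  · intro h
    exact ⟨fun p hp => (h _ _ hp.1.2.ne).1 hp.2, fun p hp hd => hp.2 ((h _ _ hp.1.2.ne).2 hd)⟩

end

/-! ### Notions used in the statement -/

/-- `ν_d(r) = 1 + d · ∑_{i < r} (d - 1)^i`. (For `d = 0` the factor `d` makes the truncated
subtraction irrelevant.) -/
def nu (d r : ℕ) : ℕ := 1 + d * ∑ i ∈ Finset.range r, (d - 1) ^ i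

/-- `w` and `w'` agree at all positions where the entry of `w` lies in `N` (not symmetric). -/
def AgreeOn {A : Type} {n : ℕ} (N : Set A) (w w' : Fin n → A) : Prop :=
  ∀ i, w i ∈ N → w i = w' i

/-- Combinations, via addition and multiplication, of terms from a set `B`. -/
inductive IsCombination (B : Term L P → Prop) : Term L P → Prop
  | base {t : Term L P} : B t → IsCombination B t
  | add {t₁ t₂ : Term L P} : IsCombination B t₁ → IsCombination B t₂ → IsCombination B (.add t₁ t₂)
  | mul {t₁ t₂ : Term L P} : IsCombination B t₁ → IsCombination B t₂ → IsCombination B (.mul t₁ t₂)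

/-- `t` is a counting term `#z'.(ψ ∧ δ_{H,2r+1})` with `|z'| ≤ m`, for a connected graph `H` and a
first-order formula `ψ`. Here the vertices of `H` correspond to the tuple `(u, z')` of pairwise
distinct variables, where the entries of `u` are among the variables `V`, and `ψ(u, z')` is
`r`-local around this tuple. -/
def IsConnectedCount [L.IsRelational] [Finite (Σ n, L.Relations n)] (r m : ℕ) (V : Set ℕ)
    (t : Term L P) : Prop :=
  ∃ (n p : ℕ) (u : Fin n → ℕ) (z' : Fin p ↪ ℕ) (H : SimpleGraph (Fin (n + p)))
    (ψ : Formula L P),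
    p ≤ m ∧ Set.range u ⊆ V ∧ Function.Injective (Fin.append u z') ∧ H.Connected ∧
    ψ.IsFO ∧ IsLocal r ψ (Fin.append u z') ∧
    t = .count z' (.and ψ (.delta H (2 * r + 1) (Fin.append u z')))

end FOC1

/-!
By Feferman–Vaught, an `r`-local formula is a disjunction of products of `r`-local formulas on any
configuration whose variables split into two groups at mutual distance greater than `2 * r + 1`.
For a disconnected graph, the corresponding count is therefore, up to inclusion–exclusion, a product
of counts for the two parts, minus the counts for the graphs with additional edges across. Induction
on the number of non-edges puts every such count into the ring generated by the counts for connected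
graphs.

In a connected configuration all values lie close to each other. Hence if the value of a variable
`yⱼ` of a connected count is far from all `vᵢ`, the count vanishes as soon as it also involves a
variable `xⱼ`, and otherwise it does not depend on `i`. It can thus be replaced by an integer, which
is at most the number of choices for the counted variables among the elements close to `w`.
-/

namespace FOC1

variable {L : FirstOrder.Language.{0, 0}} {P : NumPredicates}

/-! ### Relativized semantics -/

section Relativized

variable {A : Type} [L.Structure A]

/-- Satisfaction of a first-order formula with all quantifiers restricted to the set `X`; the values
of the free variables need not lie in `X`. Numerical predicates get the junk value `False`. -/
def Formula.RealizeOn (X : Set A) : Formula L P → (ℕ → A) → Prop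
  | .eq x y, β => β x = β y
  | .rel R x, β => FirstOrder.Language.Structure.RelMap R (fun i => β (x i))
  | .neg φ, β => ¬ φ.RealizeOn X β
  | .or φ ψ, β => φ.RealizeOn X β ∨ ψ.RealizeOn X β
  | .ex x φ, β => ∃ a ∈ X, φ.RealizeOn X (Function.update β x a)
  | .pred _ _, _ => False

theorem dependsOn_realizeOn (X : Set A) {φ : Formula L P} (hφ : φ.IsFO) :
    DependsOn (φ.RealizeOn X) φ.free := by
  induction hφ with
  | eq x y => intro β β' h; simp_all [Formula.RealizeOn, Formula.free]
  | rel R x =>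
    intro β β' h
    have : (fun i => β (x i)) = fun i => β' (x i) := funext fun i => h _ (by simp [Formula.free])
    simp only [Formula.RealizeOn, this]
  | neg _ ih => exact fun β β' h => congrArg Not (ih h)
  | or _ _ ih₁ ih₂ =>
    intro β β' h
    simp only [Formula.free, Finset.coe_union] at h
    exact congrArg₂ Or (ih₁ fun v hv => h v (.inl hv)) (ih₂ fun v hv => h v (.inr hv))
  | ex x _ ih =>
    intro β β' h
    simp only [Formula.RealizeOn, eq_iff_iff]
    refine exists_congr fun a => and_congr_right fun _ => iff_of_eq (ih fun v hv => ?_)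
    obtain rfl | hvx := eq_or_ne v x
    · simp
    · simpa [hvx] using h v (by simpa [Formula.free, hvx] using hv)

theorem realizeOn_univ {φ : Formula L P} (hφ : φ.IsFO) (β : ℕ → A) :
    φ.RealizeOn Set.univ β ↔ φ.Realize β := by
  induction hφ generalizing β <;> simp_all [Formula.RealizeOn, Formula.Realize]

theorem dependsOn_realize {φ : Formula L P} (hφ : φ.IsFO) :
    DependsOn (φ.Realize (A := A)) φ.free := fun β β' h => propext <| by
  rw [← realizeOn_univ hφ, ← realizeOn_univ hφ, dependsOn_realizeOn _ hφ h]

theorem realizeOn_and (X : Set A) (φ ψ : Formula L P) (β : ℕ → A) :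
    (φ.and ψ).RealizeOn X β ↔ φ.RealizeOn X β ∧ ψ.RealizeOn X β := by
  simp only [Formula.and, Formula.RealizeOn, not_or, not_not]

theorem realizeOn_verum {X : Set A} (hX : X.Nonempty) (β : ℕ → A) :
    (Formula.verum : Formula L P).RealizeOn X β :=
  let ⟨a, ha⟩ := hX
  ⟨a, ha, rfl⟩

variable [L.IsRelational]

theorem realizeOn_induced (X : Set A) (Y : Set X) {φ : Formula L P} (hφ : φ.IsFO) (β : ℕ → X) :
    (letI := induced L X; φ.RealizeOn Y β) ↔
      φ.RealizeOn (Subtype.val '' Y) (Subtype.val ∘ β) := by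
  let := induced L X
  induction hφ generalizing β with
  | eq x y => simp [Formula.RealizeOn, Subtype.ext_iff]
  | rel R x => rfl
  | neg _ ih => exact not_congr (ih β)
  | or _ _ ih₁ ih₂ => exact or_congr (ih₁ β) (ih₂ β)
  | ex x _ ih =>
    simp only [Formula.RealizeOn, Set.exists_mem_image, ih, Function.comp_update]

theorem realize_induced (X : Set A) {φ : Formula L P} (hφ : φ.IsFO) (β : ℕ → X) :
    (letI := induced L X; φ.Realize β) ↔ φ.RealizeOn X (Subtype.val ∘ β) := by
  let := induced L X
  rw [← realizeOn_univ hφ β, realizeOn_induced X _ hφ, Set.image_univ, Subtype.range_coe]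

end Relativized

/-! ### Neighbourhoods and induced substructures -/

section Neighbourhoods

variable {A : Type} [L.Structure A] {r : ℕ} {S T : Finset ℕ} {β β' : ℕ → A}

variable (L) in
/-- The `r`-neighbourhood of the values of the variables in `S`. It replaces `ball`, which is
centred at a tuple, whenever the order of the variables is irrelevant. -/
def nbhd (r : ℕ) (S : Finset ℕ) (β : ℕ → A) : Set A :=
  {b | ∃ i ∈ S, (gaifman L A).edist (β i) b ≤ r}

theorem mem_nbhd_self {i : ℕ} (hi : i ∈ S) : β i ∈ nbhd L r S β :=
  ⟨i, hi, by simp⟩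

theorem nbhd_mono (h : S ⊆ T) : nbhd L r S β ⊆ nbhd L r T β :=
  fun _ ⟨i, hi, hb⟩ => ⟨i, h hi, hb⟩

theorem nbhd_union : nbhd L r (S ∪ T) β = nbhd L r S β ∪ nbhd L r T β := by
  ext b; simp [nbhd, or_and_right, exists_or]

variable (L) in
theorem dependsOn_nbhd (r : ℕ) (S : Finset ℕ) : DependsOn (nbhd (A := A) L r S) S := fun _ _ h =>
  Set.ext fun _ => exists_congr fun i => and_congr_right fun hi => by rw [h i hi]

theorem ball_comp_eq_nbhd {n : ℕ} (x : Fin n → ℕ) :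
    ball L r (β ∘ x) = nbhd L r (Finset.univ.image x) β := by
  ext b; simp [ball, nbhd]

theorem edist_le_one_of_relMap {n : ℕ} {R : L.Relations n} {t : Fin n → A}
    (hR : FirstOrder.Language.Structure.RelMap R t) (i j : Fin n) :
    (gaifman L A).edist (t i) (t j) ≤ 1 := by
  rw [SimpleGraph.edist_le_one_iff_adj_or_eq, or_iff_not_imp_right]
  exact fun h => ⟨h, n, R, t, hR, ⟨i, rfl⟩, ⟨j, rfl⟩⟩

variable [L.IsRelational]

theorem edist_le_edist_induced (X : Set A) (a b : X) :
    (gaifman L A).edist (a : A) b ≤ (letI := induced L X; (gaifman L X).edist a b) := by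
  let := induced L X
  by_cases h : (gaifman L X).edist a b = ⊤
  · exact h ▸ le_top
  obtain ⟨p, hp⟩ := SimpleGraph.exists_walk_of_edist_ne_top h
  let incl : gaifman L X →g gaifman L A :=
    ⟨Subtype.val, fun ⟨hne, n, R, t, hR, ⟨i, hi⟩, ⟨j, hj⟩⟩ => ⟨Subtype.coe_ne_coe.2 hne, n, R,
      Subtype.val ∘ t, hR, ⟨i, congrArg _ hi⟩, ⟨j, congrArg _ hj⟩⟩⟩
  calc (gaifman L A).edist (a : A) b ≤ (p.map incl).length := (p.map incl).edist_le
    _ = (gaifman L X).edist a b := by rw [SimpleGraph.Walk.length_map, hp]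

theorem edist_induced_le {X : Set A} {a : X} (hX : {b | (gaifman L A).edist (a : A) b ≤ r} ⊆ X)
    (b : X) (h : (gaifman L A).edist (a : A) b ≤ r) :
    (letI := induced L X; (gaifman L X).edist a b) ≤ r := by
  let := induced L X
  induction r generalizing b with
  | zero => simpa [Subtype.ext_iff] using h
  | succ r ih =>
    have hr : (r : ℕ∞) ≤ (r + 1 : ℕ) := by simp
    specialize ih fun b hb => hX (hb.trans hr)
    rw [edist_succ] at h ⊢
    rcases h with h | ⟨c, hc, hne, n, R, t, hR, ⟨i, rfl⟩, ⟨j, hj⟩⟩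
    · exact .inl (ih b h)
    have ht : ∀ e, t e ∈ X := fun e => hX <| by
      simpa using (SimpleGraph.edist_triangle (v := t i)).trans
        (add_le_add hc (edist_le_one_of_relMap hR i e))
    exact .inr ⟨⟨t i, ht i⟩, ih _ hc, Subtype.coe_ne_coe.1 hne, n, R, fun e => ⟨t e, ht e⟩, hR,
      ⟨i, rfl⟩, ⟨j, Subtype.ext hj⟩⟩

theorem image_nbhd_induced {X : Set A} {β : ℕ → X} (hX : nbhd L r S (Subtype.val ∘ β) ⊆ X) :
    Subtype.val '' (letI := induced L X; nbhd L r S β) = nbhd L r S (Subtype.val ∘ β) := by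
  let := induced L X
  ext b
  constructor
  · rintro ⟨b, ⟨i, hi, hb⟩, rfl⟩
    exact ⟨i, hi, (edist_le_edist_induced X _ _).trans hb⟩
  · rintro ⟨i, hi, hb⟩
    exact ⟨⟨b, hX ⟨i, hi, hb⟩⟩, ⟨i, hi, edist_induced_le (fun b hb => hX ⟨i, hi, hb⟩) _ hb⟩, rfl⟩

end Neighbourhoods

/-! ### Locality -/

section Locality

variable {r : ℕ} {S T : Finset ℕ} {φ ψ : Formula L P}

/-- `φ` is a first-order formula that is `r`-local around the variables in `S`. Unlike `IsLocal`,
this is phrased without passing to a substructure. -/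
structure IsLocalAround (r : ℕ) (S : Finset ℕ) (φ : Formula L P) : Prop where
  isFO : φ.IsFO
  free_subset : φ.free ⊆ S
  realize_iff (A : Type) [Finite A] [L.Structure A] (β : ℕ → A) :
    φ.Realize β ↔ φ.RealizeOn (nbhd L r S β) β

theorem exists_valuation_subtype {A : Type} {X : Set A} (hS : S.Nonempty) {β : ℕ → A}
    (h : ∀ v ∈ S, β v ∈ X) : ∃ γ : ℕ → X, ∀ v ∈ S, (γ v : A) = β v := by
  classical
  obtain ⟨i, hi⟩ := hS
  exact ⟨fun v => if hv : v ∈ S then ⟨β v, h v hv⟩ else ⟨β i, h i hi⟩, fun v hv => by simp [hv]⟩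

theorem models_comp_iff {A : Type} [L.Structure A] {n : ℕ} (hφ : φ.IsFO) {x : Fin n → ℕ}
    (hfree : (φ.free : Set ℕ) ⊆ Set.range x) {β : ℕ → A} :
    Models A φ x (β ∘ x) ↔ φ.Realize β := by
  refine ⟨fun h => h β fun _ => rfl, fun h γ hγ => (dependsOn_realize hφ fun v hv => ?_).mp h⟩
  obtain ⟨i, rfl⟩ := hfree hv
  exact (hγ i).symm

variable [L.IsRelational]

theorem models_ball_comp_iff {A : Type} [L.Structure A] {n : ℕ} (hn : 0 < n) (hφ : φ.IsFO)
    {x : Fin n → ℕ} (hfree : (φ.free : Set ℕ) ⊆ Set.range x) (β : ℕ → A) :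
    (letI := induced L (ball L r (β ∘ x));
      Models (ball L r (β ∘ x)) φ x (fun i => ⟨β (x i), mem_ball L r (β ∘ x) i⟩)) ↔
      φ.RealizeOn (nbhd L r (Finset.univ.image x) β) β := by
  obtain ⟨γ, hγ⟩ := exists_valuation_subtype (X := ball L r (β ∘ x)) (β := β)
    (S := Finset.univ.image x) ⟨x ⟨0, hn⟩, by simp⟩ fun v hv => by
      rw [ball_comp_eq_nbhd]; exact mem_nbhd_self hv
  let := induced L (ball L r (β ∘ x))
  have hγx : (fun i => ⟨β (x i), mem_ball L r (β ∘ x) i⟩ : Fin n → ball L r (β ∘ x)) = γ ∘ x :=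
    funext fun i => Subtype.ext (hγ _ (by simp)).symm
  rw [hγx, models_comp_iff hφ hfree, realize_induced _ hφ, ← ball_comp_eq_nbhd]
  refine iff_of_eq (dependsOn_realizeOn _ hφ fun v hv => hγ v ?_)
  simpa using hfree hv

theorem isLocal_iff_isLocalAround {n : ℕ} (hn : 0 < n) (hφ : φ.IsFO) {x : Fin n → ℕ}
    (hx : Function.Injective x) : IsLocal r φ x ↔ IsLocalAround r (Finset.univ.image x) φ := by
  have hfree : (φ.free : Set ℕ) ⊆ Set.range x ↔ φ.free ⊆ Finset.univ.image x := by
    rw [← Finset.coe_subset]; simp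
  constructor
  · rintro ⟨hf, h⟩
    refine ⟨hφ, hfree.1 hf, fun A _ _ β => ?_⟩
    rw [← models_ball_comp_iff hn hφ hf, ← models_comp_iff hφ hf]
    exact h A _
  · rintro ⟨-, hf, h⟩
    refine ⟨hfree.2 hf, fun A _ _ a => ?_⟩
    have : Nonempty A := ⟨a ⟨0, hn⟩⟩
    obtain ⟨β, rfl⟩ : ∃ β : ℕ → A, β ∘ x = a :=
      ⟨Function.extend x a fun _ => Classical.arbitrary A, Function.extend_comp hx _ _⟩
    rw [models_comp_iff hφ (hfree.2 hf), h A β]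
    exact (models_ball_comp_iff hn hφ (hfree.2 hf) β).symm

theorem IsLocalAround.realizeOn_iff (hφ : IsLocalAround r S φ) (hS : S.Nonempty) {A : Type}
    [Finite A] [L.Structure A] {β : ℕ → A} {X : Set A} (hX : nbhd L r S β ⊆ X) :
    φ.RealizeOn X β ↔ φ.Realize β := by
  obtain ⟨γ, hγ⟩ := exists_valuation_subtype hS fun v hv => hX (mem_nbhd_self hv)
  let := induced L X
  have hnbhd : nbhd L r S (Subtype.val ∘ γ) = nbhd L r S β := dependsOn_nbhd L r S hγ
  have hγφ : ∀ v ∈ φ.free, (γ v : A) = β v := fun v hv => hγ v (hφ.free_subset hv)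
  calc φ.RealizeOn X β
    _ ↔ φ.RealizeOn X (Subtype.val ∘ γ) := (iff_of_eq (dependsOn_realizeOn X hφ.isFO hγφ)).symm
    _ ↔ φ.Realize γ := (realize_induced X hφ.isFO γ).symm
    _ ↔ φ.RealizeOn (nbhd L r S γ) γ := hφ.realize_iff X γ
    _ ↔ φ.RealizeOn (nbhd L r S β) (Subtype.val ∘ γ) := by
      rw [realizeOn_induced X _ hφ.isFO, image_nbhd_induced (hnbhd ▸ hX), hnbhd]
    _ ↔ φ.RealizeOn (nbhd L r S β) β := iff_of_eq (dependsOn_realizeOn _ hφ.isFO hγφ)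
    _ ↔ φ.Realize β := (hφ.realize_iff A β).symm

theorem IsLocalAround.mono (hφ : IsLocalAround r S φ) (hS : S.Nonempty) (hST : S ⊆ T) :
    IsLocalAround r T φ :=
  ⟨hφ.isFO, hφ.free_subset.trans hST, fun _ _ _ _ => (hφ.realizeOn_iff hS (nbhd_mono hST)).symm⟩

end Locality

/-! ### First-order formulas and their free variables -/

namespace Formula

theorem IsFO.isFOC1 {φ : Formula L P} (hφ : φ.IsFO) : φ.IsFOC1 := by
  induction hφ <;> simp_all [IsFOC1]

theorem IsFO.and {φ ψ : Formula L P} (hφ : φ.IsFO) (hψ : ψ.IsFO) : (φ.and ψ).IsFO :=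
  .neg (.or (.neg hφ) (.neg hψ))

theorem isFO_verum : (verum : Formula L P).IsFO := .ex _ (.eq _ _)

theorem isFO_bigAnd {l : List (Formula L P)} (h : ∀ φ ∈ l, φ.IsFO) : (bigAnd l).IsFO := by
  induction l with
  | nil => exact isFO_verum
  | cons a l ih => exact .and (h a (by simp)) (ih fun φ hφ => h φ (by simp [hφ]))

theorem isFO_bigOr {l : List (Formula L P)} (h : ∀ φ ∈ l, φ.IsFO) : (bigOr l).IsFO := by
  induction l with
  | nil => exact .neg isFO_verum
  | cons a l ih => exact .or (h a (by simp)) (ih fun φ hφ => h φ (by simp [hφ]))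

theorem IsFO.exMany (l : List ℕ) {φ : Formula L P} (hφ : φ.IsFO) : (exMany l φ).IsFO := by
  induction l with
  | nil => exact hφ
  | cons a l ih => exact .ex _ ih

theorem free_and (φ ψ : Formula L P) : (φ.and ψ).free = φ.free ∪ ψ.free := by
  simp [Formula.and, free]

theorem free_verum : (verum : Formula L P).free = ∅ := by
  simp [verum, free]

theorem free_bigAnd_subset {l : List (Formula L P)} {F : Finset ℕ} (h : ∀ φ ∈ l, φ.free ⊆ F) :
    (bigAnd l).free ⊆ F := by
  induction l with
  | nil => simp [bigAnd, free_verum]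
  | cons a l ih =>
    exact (free_and a (bigAnd l)).trans_subset
      (Finset.union_subset (h a (by simp)) (ih fun φ hφ => h φ (by simp [hφ])))

theorem free_bigOr_subset {l : List (Formula L P)} {F : Finset ℕ} (h : ∀ φ ∈ l, φ.free ⊆ F) :
    (bigOr l).free ⊆ F := by
  induction l with
  | nil => simp [bigOr, free, free_verum]
  | cons a l ih =>
    exact Finset.union_subset (h a (by simp)) (ih fun φ hφ => h φ (by simp [hφ]))

theorem free_exMany (l : List ℕ) (φ : Formula L P) : (exMany l φ).free = φ.free \ l.toFinset := by
  induction l with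
  | nil => simp [exMany]
  | cons a l ih =>
    change (exMany l φ).free \ {a} = _
    rw [ih, sdiff_sdiff_left, List.toFinset_cons, Finset.insert_eq, Finset.union_comm]
    rfl

variable [Finite (Σ n, L.Relations n)]

theorem isFO_adj (x y : ℕ) : (adj x y : Formula L P).IsFO := by
  refine .and (.neg (.eq _ _)) (isFO_bigOr fun φ hφ => ?_)
  simp only [List.mem_flatMap, List.mem_map] at hφ
  obtain ⟨R, -, ij, -, rfl⟩ := hφ
  exact .exMany _ (.and (.rel _ _) (.and (.eq _ _) (.eq _ _)))

theorem free_adj_subset (x y : ℕ) : (adj x y : Formula L P).free ⊆ {x, y} := by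
  rw [adj, free_and]
  refine Finset.union_subset (by simp [free]) (free_bigOr_subset fun φ hφ => ?_)
  simp only [List.mem_flatMap, List.mem_map] at hφ
  obtain ⟨R, -, ij, -, rfl⟩ := hφ
  rw [free_exMany]
  intro v
  simp only [free_and, free, Finset.mem_sdiff, Finset.mem_union, Finset.mem_image,
    Finset.mem_univ, true_and, Finset.mem_insert, Finset.mem_singleton, List.mem_toFinset,
    List.mem_map, List.mem_range]
  rintro ⟨⟨i, rfl⟩ | (rfl | hx) | rfl | hy, hv⟩
  · exact (hv ⟨i, i.2, rfl⟩).elim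
  · exact (hv ⟨_, ij.1.2, rfl⟩).elim
  · exact .inl hx
  · exact (hv ⟨_, ij.2.2, rfl⟩).elim
  · exact .inr hy

theorem isFO_distLE (r x y : ℕ) : (distLE r x y : Formula L P).IsFO := by
  induction r generalizing x y with
  | zero => exact .eq _ _
  | succ r ih => exact .or (ih _ _) (.ex _ (.and (ih _ _) (isFO_adj _ _)))

theorem free_distLE_subset (r x y : ℕ) : (distLE r x y : Formula L P).free ⊆ {x, y} := by
  induction r generalizing x y with
  | zero => simp [distLE, free]
  | succ r ih =>
    have h₁ := ih x y
    have h₂ := ih x (x + y + 1)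
    have h₃ := free_adj_subset (L := L) (P := P) (x + y + 1) y
    simp only [distLE, free, free_and]
    grind

theorem isFO_delta {n : ℕ} (G : SimpleGraph (Fin n)) (r : ℕ) (x : Fin n → ℕ) :
    (delta G r x : Formula L P).IsFO := by
  refine .and (isFO_bigAnd ?_) (isFO_bigAnd ?_) <;> rw [List.forall_mem_map]
  · exact fun _ _ => isFO_distLE _ _ _
  · exact fun _ _ => .neg (isFO_distLE _ _ _)

theorem free_delta_subset {n : ℕ} (G : SimpleGraph (Fin n)) (r : ℕ) (x : Fin n → ℕ) :
    (delta G r x : Formula L P).free ⊆ Finset.univ.image x := by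
  have h (i j) : (distLE r (x i) (x j) : Formula L P).free ⊆ Finset.univ.image x :=
    (free_distLE_subset r _ _).trans (by simp [Finset.insert_subset_iff])
  simp only [delta, free_and]
  refine Finset.union_subset (free_bigAnd_subset ?_) (free_bigAnd_subset ?_) <;>
    rw [List.forall_mem_map]
  · exact fun _ _ => h _ _
  · exact fun _ _ => h _ _

end Formula

theorem IsLocalAround.and {r : ℕ} {S : Finset ℕ} {φ ψ : Formula L P} (hφ : IsLocalAround r S φ)
    (hψ : IsLocalAround r S ψ) : IsLocalAround r S (φ.and ψ) where
  isFO := hφ.isFO.and hψ.isFO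
  free_subset := by
    rw [Formula.free_and]; exact Finset.union_subset hφ.free_subset hψ.free_subset
  realize_iff A _ _ β := by rw [realize_and, realizeOn_and, hφ.realize_iff, hψ.realize_iff]

/-! ### Relativization -/

/-- A variable that does not occur in `S`. -/
def fresh (S : Finset ℕ) : ℕ := S.sup id + 1

theorem fresh_notMem (S : Finset ℕ) : fresh S ∉ S := fun h => by
  have := Finset.le_sup (f := id) h
  simp only [fresh, id_eq] at this
  omega

section Relativization

variable [Finite (Σ n, L.Relations n)]

/-- `y` lies in the `r`-neighbourhood of the variables in `S`. -/
noncomputable def Formula.near (r : ℕ) (S : Finset ℕ) (y : ℕ) : Formula L P :=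
  .bigOr (S.toList.map fun i => .distLE r i y)

/-- The relativization of `φ` to the `r`-neighbourhood of the variables in `S`, with every free
variable `x` renamed to `ρ x`. Bound variables are renamed as well, as they may occur in `S`. -/
noncomputable def Formula.relativize (r : ℕ) (S : Finset ℕ) :
    Formula L P → (ℕ → ℕ) → Formula L P
  | .eq x y, ρ => .eq (ρ x) (ρ y)
  | .rel R x, ρ => .rel R (ρ ∘ x)
  | .neg φ, ρ => .neg (φ.relativize r S ρ)
  | .or φ ψ, ρ => .or (φ.relativize r S ρ) (ψ.relativize r S ρ)
  | .ex x φ, ρ =>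
    let y := fresh (S ∪ φ.free.image ρ)
    .ex y (.and (.near r S y) (φ.relativize r S (Function.update ρ x y)))
  | .pred _ _, _ => .neg .verum

variable {r : ℕ} {S : Finset ℕ} {φ : Formula L P}

theorem Formula.isFO_near (y : ℕ) : (near r S y : Formula L P).IsFO :=
  isFO_bigOr <| List.forall_mem_map.2 fun _ _ => isFO_distLE _ _ _

theorem Formula.free_near_subset (y : ℕ) : (near r S y : Formula L P).free ⊆ insert y S := by
  refine free_bigOr_subset <| List.forall_mem_map.2 fun i hi =>
    (free_distLE_subset r i y).trans ?_
  rw [Finset.mem_toList] at hi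
  simp [Finset.insert_subset_iff, hi]

theorem realize_near {A : Type} [L.Structure A] (y : ℕ) (β : ℕ → A) :
    (Formula.near r S y : Formula L P).Realize β ↔ β y ∈ nbhd L r S β := by
  simp [Formula.near, realize_bigOr, realize_distLE, nbhd]

theorem Formula.IsFO.relativize (hφ : φ.IsFO) (ρ : ℕ → ℕ) : (φ.relativize r S ρ).IsFO := by
  induction hφ generalizing ρ with
  | eq x y => exact .eq _ _
  | rel R x => exact .rel _ _
  | neg _ ih => exact .neg (ih ρ)
  | or _ _ ih₁ ih₂ => exact .or (ih₁ ρ) (ih₂ ρ)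
  | ex x _ ih => exact .ex _ (.and (isFO_near _) (ih _))

theorem Formula.IsFO.free_relativize_subset (hφ : φ.IsFO) (ρ : ℕ → ℕ) :
    (φ.relativize r S ρ).free ⊆ S ∪ φ.free.image ρ := by
  induction hφ generalizing ρ with
  | eq x y =>
    simp only [Formula.relativize, free, Finset.image_insert, Finset.image_singleton]
    exact Finset.subset_union_right
  | rel R x => simp only [Formula.relativize, free]; grind
  | neg _ ih => exact ih ρ
  | or _ _ ih₁ ih₂ => simp only [Formula.relativize, free]; grind
  | @ex x φ _ ih =>
    simp only [Formula.relativize, free, free_and]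
    generalize fresh _ = y
    have hnear := free_near_subset (L := L) (P := P) (r := r) (S := S) y
    specialize ih (Function.update ρ x y)
    intro v hv
    obtain ⟨hv, hvy⟩ := Finset.mem_sdiff.1 hv
    rcases Finset.mem_union.1 hv with hv | hv
    · grind
    · have := ih hv
      simp only [Finset.mem_union, Finset.mem_image] at this
      grind

theorem realize_relativize (hφ : φ.IsFO) (ρ : ℕ → ℕ) {A : Type} [L.Structure A] (β : ℕ → A) :
    (φ.relativize r S ρ).Realize β ↔ φ.RealizeOn (nbhd L r S β) (β ∘ ρ) := by
  induction hφ generalizing ρ β with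
  | eq x y => rfl
  | rel R x => rfl
  | neg _ ih => exact not_congr (ih ρ β)
  | or _ _ ih₁ ih₂ => exact or_congr (ih₁ ρ β) (ih₂ ρ β)
  | @ex x φ hφ ih =>
    simp only [Formula.relativize, Formula.Realize, Formula.RealizeOn, realize_and, realize_near,
      ih]
    have hy := fresh_notMem (S ∪ φ.free.image ρ)
    generalize fresh _ = y at hy ⊢
    simp only [Finset.mem_union, Finset.mem_image, not_or, not_exists, not_and] at hy
    refine exists_congr fun a => ?_
    have hnbhd : nbhd L r S (Function.update β y a) = nbhd L r S β :=
      dependsOn_nbhd L r S fun v hv => Function.update_of_ne (ne_of_mem_of_not_mem hv hy.1) _ _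
    rw [hnbhd, Function.update_self]
    refine and_congr_right fun _ => iff_of_eq (dependsOn_realizeOn _ hφ fun v hv => ?_)
    obtain rfl | hvx := eq_or_ne v x
    · simp
    · simp [hvx, hy.2 v hv]

theorem isLocalAround_relativize [L.IsRelational] (hS : S.Nonempty) (hφ : φ.IsFO)
    (hf : φ.free ⊆ S) : IsLocalAround r S (φ.relativize r S id) := by
  have hf' : (φ.relativize r S id).free ⊆ S :=
    (hφ.free_relativize_subset id).trans (Finset.union_subset subset_rfl (by simpa using hf))
  refine ⟨hφ.relativize id, hf', fun A _ _ β => ?_⟩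
  obtain ⟨γ, hγ⟩ := exists_valuation_subtype hS fun v hv =>
    mem_nbhd_self (L := L) (r := r) (β := β) hv
  let := induced L (nbhd L r S β)
  have hnbhd : nbhd L r S (Subtype.val ∘ γ) = nbhd L r S β := dependsOn_nbhd L r S hγ
  calc (φ.relativize r S id).Realize β
    _ ↔ φ.RealizeOn (nbhd L r S β) β := realize_relativize hφ id β
    _ ↔ φ.RealizeOn (nbhd L r S β) (Subtype.val ∘ γ) :=
      (iff_of_eq (dependsOn_realizeOn _ hφ fun v hv => hγ v (hf hv))).symm
    _ ↔ φ.RealizeOn (nbhd L r S γ) γ := by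
      rw [realizeOn_induced _ _ hφ, image_nbhd_induced hnbhd.subset, hnbhd]
    _ ↔ (φ.relativize r S id).Realize γ := (realize_relativize hφ id γ).symm
    _ ↔ (φ.relativize r S id).RealizeOn (nbhd L r S β) (Subtype.val ∘ γ) :=
      realize_induced _ (hφ.relativize id) γ
    _ ↔ (φ.relativize r S id).RealizeOn (nbhd L r S β) β :=
      iff_of_eq (dependsOn_realizeOn _ (hφ.relativize id) fun v hv => hγ v (hf' hv))

end Relativization

/-! ### The Feferman–Vaught decomposition -/

section FefermanVaught

/-- `φ` is a first-order formula with free variables in `F`. -/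
structure Formula.IsFOIn (F : Finset ℕ) (φ : Formula L P) : Prop where
  isFO : φ.IsFO
  free_subset : φ.free ⊆ F

variable {F F' F₁ F₂ : Finset ℕ} {φ ψ : Formula L P}

theorem Formula.isFOIn_verum : (verum : Formula L P).IsFOIn F :=
  ⟨isFO_verum, by simp [free_verum]⟩

theorem Formula.IsFOIn.neg (h : φ.IsFOIn F) : φ.neg.IsFOIn F := ⟨.neg h.isFO, h.free_subset⟩

theorem Formula.IsFOIn.and (hφ : φ.IsFOIn F) (hψ : ψ.IsFOIn F) : (φ.and ψ).IsFOIn F :=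
  ⟨hφ.isFO.and hψ.isFO, by
    rw [free_and]; exact Finset.union_subset hφ.free_subset hψ.free_subset⟩

theorem Formula.IsFOIn.mono (h : φ.IsFOIn F) (hF : F ⊆ F') : φ.IsFOIn F' :=
  ⟨h.isFO, h.free_subset.trans hF⟩

theorem Formula.IsFOIn.ex {x : ℕ} (h : φ.IsFOIn (insert x F)) : (Formula.ex x φ).IsFOIn F :=
  ⟨.ex x h.isFO, by have := h.free_subset; simp only [free]; grind⟩

theorem Formula.IsFOIn.realizeOn_update_iff {x : ℕ} (h : φ.IsFOIn (F.erase x)) {A : Type}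
    [L.Structure A] (X : Set A) (β : ℕ → A) (a : A) :
    φ.RealizeOn X (Function.update β x a) ↔ φ.RealizeOn X β :=
  iff_of_eq <| dependsOn_realizeOn X h.isFO fun _ hv =>
    Function.update_of_ne (Finset.ne_of_mem_erase (h.free_subset hv)) _ _

/-- The valuation `β` maps `F₁` and `F₂` into nonempty sets `X₁` and `X₂` without edges of the
Gaifman graph, or common elements, between them. -/
structure IsSplitting {A : Type} [L.Structure A] (F₁ F₂ : Finset ℕ) (X₁ X₂ : Set A)
    (β : ℕ → A) : Prop where
  left_nonempty : X₁.Nonempty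
  right_nonempty : X₂.Nonempty
  one_lt_edist : ∀ a ∈ X₁, ∀ b ∈ X₂, 1 < (gaifman L A).edist a b
  left_mem : ∀ v ∈ F₁, β v ∈ X₁
  right_mem : ∀ v ∈ F₂, β v ∈ X₂

/-- `φ` has a Feferman–Vaught decomposition: on `X₁ ∪ X₂` it is equivalent to a finite disjunction
of conjunctions of a formula on `X₁` and a formula on `X₂`, uniformly in the splitting. -/
def IsSeparable (F₁ F₂ : Finset ℕ) (φ : Formula L P) : Prop :=
  ∃ l : List (Formula L P × Formula L P), (∀ p ∈ l, p.1.IsFOIn F₁ ∧ p.2.IsFOIn F₂) ∧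
    ∀ (A : Type) [L.Structure A] (X₁ X₂ : Set A) (β : ℕ → A),
      IsSplitting (L := L) F₁ F₂ X₁ X₂ β →
        (φ.RealizeOn (X₁ ∪ X₂) β ↔ ∃ p ∈ l, p.1.RealizeOn X₁ β ∧ p.2.RealizeOn X₂ β)

section Splitting

variable {A : Type} [L.Structure A] {X₁ X₂ : Set A} {β : ℕ → A} {x : ℕ} {a : A}

theorem IsSplitting.update_left (h : IsSplitting (L := L) F₁ F₂ X₁ X₂ β) (ha : a ∈ X₁) :
    IsSplitting (L := L) (insert x F₁) (F₂.erase x) X₁ X₂ (Function.update β x a) where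
  left_nonempty := h.left_nonempty
  right_nonempty := h.right_nonempty
  one_lt_edist := h.one_lt_edist
  left_mem v hv := by have := h.left_mem v; grind
  right_mem v hv := by have := h.right_mem v; grind

theorem IsSplitting.update_right (h : IsSplitting (L := L) F₁ F₂ X₁ X₂ β) (ha : a ∈ X₂) :
    IsSplitting (L := L) (F₁.erase x) (insert x F₂) X₁ X₂ (Function.update β x a) where
  left_nonempty := h.left_nonempty
  right_nonempty := h.right_nonempty
  one_lt_edist := h.one_lt_edist
  left_mem v hv := by have := h.left_mem v; grind
  right_mem v hv := by have := h.right_mem v; grind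

end Splitting

theorem isSeparable_eq {x y : ℕ} (hx : x ∈ F₁ ∪ F₂) (hy : y ∈ F₁ ∪ F₂) :
    IsSeparable F₁ F₂ (.eq x y : Formula L P) := by
  have hFO {F : Finset ℕ} (hx : x ∈ F) (hy : y ∈ F) : (.eq x y : Formula L P).IsFOIn F :=
    ⟨.eq x y, by simp [Formula.free, Finset.insert_subset_iff, hx, hy]⟩
  by_cases h₁ : x ∈ F₁ ∧ y ∈ F₁
  · refine ⟨[(.eq x y, .verum)], ?_, fun A _ X₁ X₂ β h => ?_⟩
    · simpa using ⟨hFO h₁.1 h₁.2, Formula.isFOIn_verum⟩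
    · simp [Formula.RealizeOn, realizeOn_verum h.right_nonempty]
  by_cases h₂ : x ∈ F₂ ∧ y ∈ F₂
  · refine ⟨[(.verum, .eq x y)], ?_, fun A _ X₁ X₂ β h => ?_⟩
    · simpa using ⟨Formula.isFOIn_verum, hFO h₂.1 h₂.2⟩
    · simp [Formula.RealizeOn, realizeOn_verum h.left_nonempty]
  · refine ⟨[], by simp, fun A _ X₁ X₂ β h => ?_⟩
    simp only [Formula.RealizeOn, List.not_mem_nil, false_and, exists_false, iff_false]
    intro hxy
    rcases Finset.mem_union.1 hx with hx | hx
    · have := h.one_lt_edist _ (h.left_mem x hx) _ (h.right_mem y (by grind))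
      simp [hxy] at this
    · have := h.one_lt_edist _ (h.left_mem y (by grind)) _ (h.right_mem x hx)
      simp [hxy] at this

theorem isSeparable_rel {n : ℕ} (R : L.Relations n) {x : Fin n → ℕ} (hx : ∀ i, x i ∈ F₁ ∪ F₂) :
    IsSeparable F₁ F₂ (.rel R x : Formula L P) := by
  have hFO {F : Finset ℕ} (hx : ∀ i, x i ∈ F) : (.rel R x : Formula L P).IsFOIn F :=
    ⟨.rel R x, by simpa [Formula.free, Finset.image_subset_iff] using hx⟩
  by_cases h₁ : ∀ i, x i ∈ F₁
  · refine ⟨[(.rel R x, .verum)], ?_, fun A _ X₁ X₂ β h => ?_⟩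
    · simpa using ⟨hFO h₁, Formula.isFOIn_verum⟩
    · simp [Formula.RealizeOn, realizeOn_verum h.right_nonempty]
  by_cases h₂ : ∀ i, x i ∈ F₂
  · refine ⟨[(.verum, .rel R x)], ?_, fun A _ X₁ X₂ β h => ?_⟩
    · simpa using ⟨Formula.isFOIn_verum, hFO h₂⟩
    · simp [Formula.RealizeOn, realizeOn_verum h.left_nonempty]
  · refine ⟨[], by simp, fun A _ X₁ X₂ β h => ?_⟩
    simp only [Formula.RealizeOn, List.not_mem_nil, false_and, exists_false, iff_false]
    intro hR
    push Not at h₁ h₂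
    obtain ⟨i, hi⟩ := h₁
    obtain ⟨j, hj⟩ := h₂
    exact (h.one_lt_edist _ (h.left_mem _ ((Finset.mem_union.1 (hx j)).resolve_right hj)) _
      (h.right_mem _ ((Finset.mem_union.1 (hx i)).resolve_left hi))).not_ge
        (edist_le_one_of_relMap hR j i)

theorem exists_not_exists_pair_iff (l : List (Formula L P × Formula L P))
    (hl : ∀ p ∈ l, p.1.IsFOIn F₁ ∧ p.2.IsFOIn F₂) :
    ∃ l' : List (Formula L P × Formula L P), (∀ p ∈ l', p.1.IsFOIn F₁ ∧ p.2.IsFOIn F₂) ∧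
      ∀ (A : Type) [L.Structure A] (X₁ X₂ : Set A), X₁.Nonempty → X₂.Nonempty → ∀ β : ℕ → A,
        (¬ ∃ p ∈ l, p.1.RealizeOn X₁ β ∧ p.2.RealizeOn X₂ β) ↔
          ∃ p ∈ l', p.1.RealizeOn X₁ β ∧ p.2.RealizeOn X₂ β := by
  induction l with
  | nil =>
    refine ⟨[(.verum, .verum)], ?_, fun A _ X₁ X₂ h₁ h₂ β => ?_⟩
    · simp [Formula.isFOIn_verum]
    · simp [realizeOn_verum, h₁, h₂]
  | cons p l ih =>
    obtain ⟨l', hl', hiff⟩ := ih fun q hq => hl q (by simp [hq])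
    obtain ⟨hp₁, hp₂⟩ := hl p (by simp)
    refine ⟨l'.map (fun q => (.and (.neg p.1) q.1, q.2)) ++
      l'.map (fun q => (q.1, .and (.neg p.2) q.2)), ?_, fun A _ X₁ X₂ h₁ h₂ β => ?_⟩
    · simp only [List.mem_append, List.mem_map]
      rintro _ (⟨q, hq, rfl⟩ | ⟨q, hq, rfl⟩)
      · exact ⟨hp₁.neg.and (hl' q hq).1, (hl' q hq).2⟩
      · exact ⟨(hl' q hq).1, hp₂.neg.and (hl' q hq).2⟩
    · simp only [List.mem_cons, or_and_right, exists_or, exists_eq_left, not_or,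
        hiff A X₁ X₂ h₁ h₂ β, List.mem_append, List.mem_map, exists_exists_and_eq_and,
        realizeOn_and, Formula.RealizeOn]
      rw [not_and_or, or_and_right, ← exists_and_left, ← exists_and_left]
      refine or_congr (exists_congr fun q => ?_) (exists_congr fun q => ?_) <;> tauto

theorem IsSeparable.neg (hφ : IsSeparable F₁ F₂ φ) : IsSeparable F₁ F₂ φ.neg := by
  obtain ⟨l, hl, hiff⟩ := hφ
  obtain ⟨l', hl', hnot⟩ := exists_not_exists_pair_iff l hl
  exact ⟨l', hl', fun A _ X₁ X₂ β h => (not_congr (hiff A X₁ X₂ β h)).trans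
    (hnot A X₁ X₂ h.left_nonempty h.right_nonempty β)⟩

theorem IsSeparable.or (hφ : IsSeparable F₁ F₂ φ) (hψ : IsSeparable F₁ F₂ ψ) :
    IsSeparable F₁ F₂ (φ.or ψ) := by
  obtain ⟨l, hl, hφl⟩ := hφ
  obtain ⟨l', hl', hψl'⟩ := hψ
  refine ⟨l ++ l', fun p hp => (List.mem_append.1 hp).elim (hl p) (hl' p),
    fun A _ X₁ X₂ β h => ?_⟩
  simp only [Formula.RealizeOn, List.mem_append, or_and_right, exists_or]
  exact or_congr (hφl A X₁ X₂ β h) (hψl' A X₁ X₂ β h)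

theorem IsSeparable.ex {x : ℕ} (h₁ : IsSeparable (insert x F₁) (F₂.erase x) φ)
    (h₂ : IsSeparable (F₁.erase x) (insert x F₂) φ) : IsSeparable F₁ F₂ (.ex x φ) := by
  obtain ⟨l₁, hl₁, hiff₁⟩ := h₁
  obtain ⟨l₂, hl₂, hiff₂⟩ := h₂
  refine ⟨l₁.map (fun p => (.ex x p.1, p.2)) ++ l₂.map (fun p => (p.1, .ex x p.2)), ?_,
    fun A _ X₁ X₂ β h => ?_⟩
  · simp only [List.mem_append, List.mem_map]
    rintro _ (⟨p, hp, rfl⟩ | ⟨p, hp, rfl⟩)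
    · exact ⟨(hl₁ p hp).1.ex, (hl₁ p hp).2.mono (Finset.erase_subset _ _)⟩
    · exact ⟨(hl₂ p hp).1.mono (Finset.erase_subset _ _), (hl₂ p hp).2.ex⟩
  have hleft (a) (ha : a ∈ X₁) : φ.RealizeOn (X₁ ∪ X₂) (Function.update β x a) ↔
      ∃ p ∈ l₁, p.1.RealizeOn X₁ (Function.update β x a) ∧ p.2.RealizeOn X₂ β :=
    (hiff₁ A X₁ X₂ _ (h.update_left ha)).trans <| exists_congr fun p => and_congr_right fun hp =>
      and_congr_right fun _ => (hl₁ p hp).2.realizeOn_update_iff X₂ β a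
  have hright (a) (ha : a ∈ X₂) : φ.RealizeOn (X₁ ∪ X₂) (Function.update β x a) ↔
      ∃ p ∈ l₂, p.1.RealizeOn X₁ β ∧ p.2.RealizeOn X₂ (Function.update β x a) :=
    (hiff₂ A X₁ X₂ _ (h.update_right ha)).trans <| exists_congr fun p => and_congr_right fun hp =>
      and_congr_left fun _ => (hl₂ p hp).1.realizeOn_update_iff X₁ β a
  calc (∃ a ∈ X₁ ∪ X₂, φ.RealizeOn (X₁ ∪ X₂) (Function.update β x a))
    _ ↔ (∃ a ∈ X₁, ∃ p ∈ l₁, p.1.RealizeOn X₁ (Function.update β x a) ∧ p.2.RealizeOn X₂ β) ∨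
        ∃ a ∈ X₂, ∃ p ∈ l₂, p.1.RealizeOn X₁ β ∧ p.2.RealizeOn X₂ (Function.update β x a) := by
      simp only [Set.mem_union, or_and_right, exists_or]
      exact or_congr (exists_congr fun a => and_congr_right (hleft a))
        (exists_congr fun a => and_congr_right (hright a))
    _ ↔ _ := by
      simp only [List.mem_append, List.mem_map, or_and_right, exists_or, Formula.RealizeOn,
        exists_exists_and_eq_and]
      exact or_congr (by tauto) (by tauto)

theorem Formula.IsFO.isSeparable (hφ : φ.IsFO) (hf : φ.free ⊆ F₁ ∪ F₂) : IsSeparable F₁ F₂ φ := by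
  induction hφ generalizing F₁ F₂ with
  | eq x y => exact isSeparable_eq (hf (by simp [free])) (hf (by simp [free]))
  | rel R x => exact isSeparable_rel R fun i => hf (by simp [free])
  | neg _ ih => exact (ih hf).neg
  | or _ _ ih₁ ih₂ =>
    exact (ih₁ (Finset.union_subset_left hf)).or (ih₂ (Finset.union_subset_right hf))
  | ex x _ ih =>
    have hx {S : Finset ℕ} (hS : insert x (F₁ ∪ F₂) ⊆ S) {ψ : Formula L P}
        (hψ : (Formula.ex x ψ).free ⊆ F₁ ∪ F₂) : ψ.free ⊆ S := fun v hv => hS <| by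
      have := @hψ v
      simp only [free, Finset.mem_sdiff, Finset.mem_singleton, Finset.mem_insert] at this ⊢
      tauto
    exact (ih (hx (by grind) hf)).ex (ih (hx (by grind) hf))

theorem one_lt_edist_of_mem_nbhd {A : Type} [L.Structure A] {r : ℕ} {S₁ S₂ : Finset ℕ} {β : ℕ → A}
    (hfar : ∀ i ∈ S₁, ∀ j ∈ S₂, ¬ (gaifman L A).edist (β i) (β j) ≤ (2 * r + 1 : ℕ)) {a b : A}
    (ha : a ∈ nbhd L r S₁ β) (hb : b ∈ nbhd L r S₂ β) : 1 < (gaifman L A).edist a b := by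
  obtain ⟨i, hi, hia⟩ := ha
  obtain ⟨j, hj, hjb⟩ := hb
  rw [SimpleGraph.edist_comm] at hjb
  by_contra! hab
  refine hfar i hi j hj ?_
  calc (gaifman L A).edist (β i) (β j)
    _ ≤ (gaifman L A).edist (β i) a + ((gaifman L A).edist a b + (gaifman L A).edist b (β j)) :=
      SimpleGraph.edist_triangle.trans (add_le_add_right SimpleGraph.edist_triangle _)
    _ ≤ r + (1 + r) := by gcongr
    _ = (2 * r + 1 : ℕ) := by push_cast; ring

theorem IsLocalAround.exists_split [L.IsRelational] [Finite (Σ n, L.Relations n)] {r : ℕ}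
    {S₁ S₂ : Finset ℕ} (h₁ : S₁.Nonempty) (h₂ : S₂.Nonempty) (hφ : IsLocalAround r (S₁ ∪ S₂) φ) :
    ∃ l : List (Formula L P × Formula L P),
      (∀ p ∈ l, IsLocalAround r S₁ p.1 ∧ IsLocalAround r S₂ p.2) ∧
      ∀ (A : Type) [Finite A] [L.Structure A] (β : ℕ → A),
        (∀ i ∈ S₁, ∀ j ∈ S₂, ¬ (gaifman L A).edist (β i) (β j) ≤ (2 * r + 1 : ℕ)) →
        (φ.Realize β ↔ ∃ p ∈ l, p.1.Realize β ∧ p.2.Realize β) := by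
  obtain ⟨l, hl, hsplit⟩ := hφ.isFO.isSeparable hφ.free_subset
  refine ⟨l.map fun p => (p.1.relativize r S₁ id, p.2.relativize r S₂ id),
    List.forall_mem_map.2 fun p hp =>
      ⟨isLocalAround_relativize h₁ (hl p hp).1.isFO (hl p hp).1.free_subset,
        isLocalAround_relativize h₂ (hl p hp).2.isFO (hl p hp).2.free_subset⟩,
    fun A _ _ β hfar => ?_⟩
  have h : IsSplitting (L := L) S₁ S₂ (nbhd L r S₁ β) (nbhd L r S₂ β) β :=
    { left_nonempty := h₁.imp' β fun _ => mem_nbhd_self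
      right_nonempty := h₂.imp' β fun _ => mem_nbhd_self
      one_lt_edist := fun _ ha _ hb => one_lt_edist_of_mem_nbhd hfar ha hb
      left_mem := fun _ => mem_nbhd_self
      right_mem := fun _ => mem_nbhd_self }
  rw [hφ.realize_iff, nbhd_union, hsplit A _ _ β h]
  simp only [List.mem_map, exists_exists_and_eq_and]
  refine exists_congr fun p => and_congr_right fun hp => ?_
  rw [realize_relativize (hl p hp).1.isFO, realize_relativize (hl p hp).2.isFO, Function.comp_id]

end FefermanVaught

/-! ### Counting satisfying valuations -/

section Counting

/-- A finite `L`-structure, bundled so that quantities and properties below form Pi types. -/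
structure FinStructure (L : FirstOrder.Language.{0, 0}) where
  carrier : Type
  [finite : Finite carrier]
  [str : L.Structure carrier]

namespace FinStructure

instance : CoeSort (FinStructure L) Type := ⟨carrier⟩

attribute [instance] finite str

end FinStructure

/-- An integer depending on a finite structure and a valuation. These form a commutative ring under
the pointwise operations. -/
abbrev Quantity (L : FirstOrder.Language.{0, 0}) := ∀ A : FinStructure L, (ℕ → A) → ℤ

/-- A semantic property of valuations in finite structures. These form a distributive lattice. -/
abbrev Property (L : FirstOrder.Language.{0, 0}) := ∀ A : FinStructure L, (ℕ → A) → Prop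

/-- The value of a term as a quantity. -/
noncomputable def Term.quantity (t : Term L P) : Quantity L := fun _ β => t.eval β

/-- The property defined by a formula. -/
def Formula.property (φ : Formula L P) : Property L := fun _ β => φ.Realize β

theorem property_and (φ ψ : Formula L P) : (φ.and ψ).property = φ.property ⊓ ψ.property :=
  funext fun _ => funext fun β => propext (realize_and φ ψ β)

/-- The number of ways to change the values of the variables in `T` such that `Q` holds. -/
noncomputable def count (T : Finset ℕ) (Q : Property L) : Quantity L := fun A β =>
  ({γ | (∀ v ∉ T, γ v = β v) ∧ Q A γ}.ncard : ℤ)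

variable {T T₁ T₂ S₁ S₂ : Finset ℕ} {Q Q₁ Q₂ : Property L}

theorem finite_setOf_eq_off {A : Type} [Finite A] (T : Finset ℕ) (β : ℕ → A) :
    {γ : ℕ → A | ∀ v ∉ T, γ v = β v}.Finite := by
  refine .of_injOn (f := fun γ (i : T) => γ i) (fun _ _ => Set.mem_univ _)
    (fun γ hγ γ' hγ' h => funext fun v => ?_) Set.finite_univ
  by_cases hv : v ∈ T
  · exact congrFun h ⟨v, hv⟩
  · rw [hγ v hv, hγ' v hv]

theorem finite_solutions (T : Finset ℕ) (Q : Property L) (A : FinStructure L) (β : ℕ → A) :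
    {γ | (∀ v ∉ T, γ v = β v) ∧ Q A γ}.Finite :=
  (finite_setOf_eq_off T β).subset fun _ h => h.1

theorem count_bot (T : Finset ℕ) : count T (⊥ : Property L) = 0 := by
  ext A β; simp [count]

theorem count_sup (T : Finset ℕ) (Q₁ Q₂ : Property L) :
    count T (Q₁ ⊔ Q₂) = count T Q₁ + count T Q₂ - count T (Q₁ ⊓ Q₂) := by
  ext A β
  have h := Set.ncard_union_add_ncard_inter _ _ (finite_solutions T Q₁ A β)
    (finite_solutions T Q₂ A β)
  simp only [← Set.ofPred_or, ← Set.ofPred_and, ← and_or_left, ← and_and_left] at h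
  simp only [Pi.sub_apply, Pi.add_apply, eq_sub_iff_add_eq]
  simp only [count]
  exact_mod_cast h

theorem count_eq_sum_fiber {κ : Type} (T : Finset ℕ) (Q : Property L)
    (f : ∀ A : FinStructure L, (ℕ → A) → κ) {s : Finset κ} (hf : ∀ A γ, f A γ ∈ s) :
    count T Q = ∑ e ∈ s, count T (Q ⊓ fun A γ => f A γ = e) := by
  classical
  ext A β
  simp only [count, Finset.sum_apply, Set.ncard_eq_toFinset_card _ (finite_solutions T _ A β)]
  rw [Finset.card_eq_sum_card_fiberwise (f := f A) (t := s) fun γ _ => hf A γ, Nat.cast_sum]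
  congr! 3
  ext γ
  simp [and_assoc]

theorem count_mul (hd : Disjoint S₁ S₂) (hT₁ : T₁ ⊆ S₁) (hT₂ : T₂ ⊆ S₂)
    (hQ₁ : ∀ A, DependsOn (Q₁ A) S₁) (hQ₂ : ∀ A, DependsOn (Q₂ A) S₂) :
    count T₁ Q₁ * count T₂ Q₂ = count (T₁ ∪ T₂) (Q₁ ⊓ Q₂) := by
  ext A β
  have hd : ∀ v ∈ S₁, v ∉ S₂ := fun _ => @Finset.disjoint_left.1 hd _
  simp only [Pi.mul_apply, count, ← Nat.cast_mul, ← Set.ncard_prod]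
  refine congrArg _ (Set.BijOn.ncard_eq (f := fun p => T₁.piecewise p.1 p.2) <|
    Set.InvOn.bijOn (f' := fun γ => (T₁.piecewise γ β, T₂.piecewise γ β)) ⟨?_, ?_⟩ ?_ ?_)
  · rintro ⟨γ₁, γ₂⟩ ⟨⟨h₁, -⟩, h₂, -⟩
    ext v <;> simp only [Finset.piecewise] <;> grind
  · rintro γ ⟨h, -⟩
    ext v
    simp only [Finset.piecewise]
    grind
  · rintro ⟨γ₁, γ₂⟩ ⟨⟨h₁, h₁'⟩, h₂, h₂'⟩
    refine ⟨fun v hv => by simp only [Finset.piecewise]; grind,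
      (hQ₁ A fun v hv => ?_).mp h₁', (hQ₂ A fun v hv => ?_).mp h₂'⟩ <;>
    · simp only [Finset.piecewise]
      grind
  · rintro γ ⟨h, h₁, h₂⟩
    refine ⟨⟨fun v hv => by simp [hv], (hQ₁ A fun v hv => ?_).mp h₁⟩,
      fun v hv => by simp [hv], (hQ₂ A fun v hv => ?_).mp h₂⟩ <;>
    · simp only [Finset.piecewise]
      grind

theorem quantity_count {n : ℕ} (x : Fin n ↪ ℕ) (φ : Formula L P) :
    (Term.count x φ).quantity = count (Finset.univ.image x) φ.property := by
  ext A β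
  have hext : ∀ γ ∈ {γ | (∀ v ∉ Finset.univ.image x, γ v = β v) ∧ φ.property A γ},
      Function.extend x (γ ∘ x) β = γ := fun γ hγ => funext fun v => by
    by_cases hv : ∃ i, x i = v
    · obtain ⟨i, rfl⟩ := hv
      exact x.injective.extend_apply _ _ i
    · exact (Function.extend_apply' _ _ _ hv).trans (hγ.1 v (by simpa using hv)).symm
  refine congrArg _ (Set.BijOn.ncard_eq (f := fun a => Function.extend x a β) <|
    Set.InvOn.bijOn (f' := (· ∘ x)) ⟨fun a _ => Function.extend_comp x.injective a β, hext⟩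
      (fun a ha => ⟨fun v hv => ?_, ha⟩) fun γ hγ => ?_)
  · exact Function.extend_apply' _ _ _ fun ⟨i, hi⟩ => hv (by simp [← hi])
  · exact (congrArg φ.Realize (hext γ hγ)).mpr hγ.2

/-- Inclusion–exclusion: a valuation on a distributive lattice takes values in `N` on the finite
suprema of an `inf`-closed set as soon as it does so on the set itself. -/
theorem map_finsetSup_mem {α M ι : Type*} [DistribLattice α] [OrderBot α] [AddCommGroup M]
    {N : AddSubgroup M} {f : α → M} (hbot : f ⊥ ∈ N)
    (hsup : ∀ a b, f (a ⊔ b) = f a + f b - f (a ⊓ b)) {C : Set α} (hC : InfClosed C)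
    (hf : ∀ a ∈ C, f a ∈ N) (s : Finset ι) {g : ι → α} (hg : ∀ i ∈ s, g i ∈ C) :
    f (s.sup g) ∈ N := by
  classical
  induction s using Finset.induction_on generalizing g with
  | empty => simpa using hbot
  | insert i s _ ih =>
    have hi : g i ∈ C := hg i (Finset.mem_insert_self i s)
    have hs : ∀ j ∈ s, g j ∈ C := fun j hj => hg j (Finset.mem_insert_of_mem hj)
    rw [Finset.sup_insert, hsup, Finset.sup_inf_distrib_left]
    exact N.sub_mem (N.add_mem (hf _ hi) (ih hs)) (ih fun j hj => hC hi (hs j hj))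

end Counting

/-! ### Distance patterns -/

section Configurations

variable {R : ℕ} {S S₁ S₂ T Z : Finset ℕ} {G : SimpleGraph ℕ} {E : Finset (ℕ × ℕ)}

variable (L) in
/-- Among the values of the variables in `S`, exactly those joined by an edge of `G` are at distance
at most `R`. This is the semantics of `Formula.delta`, with vertices named by variables. -/
def distPattern (R : ℕ) (S : Finset ℕ) (G : SimpleGraph ℕ) : Property L := fun A β =>
  ∀ i ∈ S, ∀ j ∈ S, i ≠ j → (G.Adj i j ↔ (gaifman L A).edist (β i) (β j) ≤ R)

theorem dependsOn_distPattern (R : ℕ) (S : Finset ℕ) (G : SimpleGraph ℕ) (A : FinStructure L) :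
    DependsOn (distPattern L R S G A) S := fun _ _ h =>
  propext <| forall₂_congr fun i hi => forall₂_congr fun j hj => by rw [h i hi, h j hj]

theorem property_delta [Finite (Σ n, L.Relations n)] {n : ℕ} {e : Fin n → ℕ}
    (he : Function.Injective e) : (Formula.delta (G.comap e) R e : Formula L P).property =
      distPattern L R (Finset.univ.image e) G := by
  ext A β
  simp [Formula.property, realize_delta, distPattern, he.ne_iff]

/-- The graph `G` together with the edges in `E`. -/
def addEdges (G : SimpleGraph ℕ) (E : Finset (ℕ × ℕ)) : SimpleGraph ℕ :=
  G ⊔ SimpleGraph.fromRel fun i j => (i, j) ∈ E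

theorem addEdges_adj {i j : ℕ} :
    (addEdges G E).Adj i j ↔ G.Adj i j ∨ i ≠ j ∧ ((i, j) ∈ E ∨ (j, i) ∈ E) := by
  simp [addEdges]

theorem addEdges_empty : addEdges G ∅ = G := by
  ext; simp [addEdges_adj]

open Classical in
variable (L) in
/-- The pairs in `S₁ × S₂` whose values are at distance at most `R`. -/
noncomputable def closePairs (R : ℕ) (S₁ S₂ : Finset ℕ) (A : FinStructure L) (β : ℕ → A) :
    Finset (ℕ × ℕ) :=
  (S₁ ×ˢ S₂).filter fun p => (gaifman L A).edist (β p.1) (β p.2) ≤ R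

theorem distPattern_mono (h : S ⊆ T) : distPattern L R T G ≤ distPattern L R S G :=
  fun _ _ hc i hi j hj => hc i (h hi) j (h hj)

theorem distPattern_congr {G' : SimpleGraph ℕ} (h : ∀ i ∈ S, ∀ j ∈ S, G.Adj i j ↔ G'.Adj i j) :
    distPattern L R S G = distPattern L R S G' := by
  ext A β
  exact forall₂_congr fun i hi => forall₂_congr fun j hj => by rw [h i hi j hj]

theorem distPattern_union_iff (hd : Disjoint S₁ S₂) (A : FinStructure L) (β : ℕ → A) :
    distPattern L R (S₁ ∪ S₂) G A β ↔ distPattern L R S₁ G A β ∧ distPattern L R S₂ G A β ∧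
      ∀ i ∈ S₁, ∀ j ∈ S₂, (G.Adj i j ↔ (gaifman L A).edist (β i) (β j) ≤ R) := by
  refine ⟨fun h => ⟨distPattern_mono Finset.subset_union_left A β h,
    distPattern_mono Finset.subset_union_right A β h, fun i hi j hj => ?_⟩, fun ⟨h₁, h₂, h⟩ => ?_⟩
  · exact h i (Finset.mem_union_left _ hi) j (Finset.mem_union_right _ hj)
      (Finset.disjoint_iff_ne.1 hd i hi j hj)
  · intro i hi j hj hij
    rcases Finset.mem_union.1 hi with hi | hi <;> rcases Finset.mem_union.1 hj with hj | hj
    · exact h₁ i hi j hj hij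
    · exact h i hi j hj
    · rw [G.adj_comm, SimpleGraph.edist_comm]
      exact h j hj i hi
    · exact h₂ i hi j hj hij

theorem distPattern_union_addEdges (hd : Disjoint S₁ S₂) (hG : ∀ i ∈ S₁, ∀ j ∈ S₂, ¬ G.Adj i j)
    (hE : E ⊆ S₁ ×ˢ S₂) : distPattern L R (S₁ ∪ S₂) (addEdges G E) =
      distPattern L R S₁ G ⊓ distPattern L R S₂ G ⊓ fun A β => closePairs L R S₁ S₂ A β = E := by
  have hd' : ∀ i ∈ S₁, i ∉ S₂ := fun _ => @Finset.disjoint_left.1 hd _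
  have hE' : ∀ i j, (i, j) ∈ E → i ∈ S₁ ∧ j ∈ S₂ := fun i j h => Finset.mem_product.1 (hE h)
  ext A β
  rw [distPattern_union_iff hd, distPattern_congr (S := S₁) (G' := G) (by grind [addEdges_adj]),
    distPattern_congr (S := S₂) (G' := G) (by grind [addEdges_adj]), ← and_assoc]
  refine and_congr_right fun _ => ?_
  simp only [closePairs, Finset.ext_iff, Finset.mem_filter, Finset.mem_product, Prod.forall,
    addEdges_adj]
  grind

theorem exists_split_of_not_connected (hS : S.Nonempty) (h : ¬ (G.induce (S : Set ℕ)).Connected) :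
    ∃ S₁ S₂ : Finset ℕ, S₁.Nonempty ∧ S₂.Nonempty ∧ Disjoint S₁ S₂ ∧ S = S₁ ∪ S₂ ∧
      ∀ i ∈ S₁, ∀ j ∈ S₂, ¬ G.Adj i j := by
  classical
  have : Nonempty (S : Set ℕ) := hS.to_subtype
  obtain ⟨a, b, hab⟩ : ∃ a b, ¬ (G.induce (S : Set ℕ)).Reachable a b := by
    by_contra! hr
    exact h ⟨hr⟩
  let C : Set ℕ := Subtype.val '' {c | (G.induce (S : Set ℕ)).Reachable a c}
  have hC (c : (S : Set ℕ)) : (c : ℕ) ∈ C ↔ (G.induce (S : Set ℕ)).Reachable a c := by simp [C]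
  refine ⟨S.filter (· ∈ C), S.filter (· ∉ C), ⟨a, ?_⟩, ⟨b, ?_⟩,
    Finset.disjoint_filter_filter_not _ _ _, (Finset.filter_union_filter_not_eq _ _).symm, ?_⟩
  · exact Finset.mem_filter.2 ⟨a.2, (hC a).2 .rfl⟩
  · exact Finset.mem_filter.2 ⟨b.2, fun hb => hab ((hC b).1 hb)⟩
  · intro i hi j hj hij
    rw [Finset.mem_filter] at hi hj
    have hij' : (G.induce (S : Set ℕ)).Adj ⟨i, hi.1⟩ ⟨j, hj.1⟩ := hij
    exact hj.2 ((hC ⟨j, hj.1⟩).2 (((hC ⟨i, hi.1⟩).1 hi.2).trans hij'.reachable))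

open Classical in
/-- The ordered pairs of elements of `S` not joined by an edge of `G`; the diagonal is included, so
that the number of these pairs also decreases with `S`. -/
noncomputable def nonEdges (S : Finset ℕ) (G : SimpleGraph ℕ) : Finset (ℕ × ℕ) :=
  (S ×ˢ S).filter fun p => ¬ G.Adj p.1 p.2

theorem mem_nonEdges {i j : ℕ} : (i, j) ∈ nonEdges S G ↔ (i ∈ S ∧ j ∈ S) ∧ ¬ G.Adj i j := by
  simp [nonEdges]

theorem card_nonEdges_lt_of_ssubset (h : S ⊂ T) : (nonEdges S G).card < (nonEdges T G).card := by
  classical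
  obtain ⟨i, hi, hi'⟩ := Finset.exists_of_ssubset h
  refine Finset.card_lt_card (Finset.ssubset_iff_of_subset ?_ |>.2 ⟨(i, i), ?_, ?_⟩)
  · exact Finset.filter_subset_filter _ (Finset.product_subset_product h.1 h.1)
  · simp [mem_nonEdges, hi]
  · simp [mem_nonEdges, hi']

theorem card_nonEdges_addEdges_lt (hd : Disjoint S₁ S₂) (hG : ∀ i ∈ S₁, ∀ j ∈ S₂, ¬ G.Adj i j)
    (hE : E ⊆ S₁ ×ˢ S₂) (hne : E.Nonempty) :
    (nonEdges (S₁ ∪ S₂) (addEdges G E)).card < (nonEdges (S₁ ∪ S₂) G).card := by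
  classical
  obtain ⟨⟨i, j⟩, hij⟩ := hne
  obtain ⟨hi, hj⟩ := Finset.mem_product.1 (hE hij)
  have hne : i ≠ j := Finset.disjoint_iff_ne.1 hd i hi j hj
  refine Finset.card_lt_card (Finset.ssubset_iff_of_subset ?_ |>.2 ⟨(i, j), ?_, ?_⟩)
  · exact Finset.monotone_filter_right _ fun p _ hp hG => hp (addEdges_adj.2 (.inl hG))
  · simp [mem_nonEdges, hi, hj, hG i hi j hj]
  · simp [mem_nonEdges, addEdges_adj, hij, hne]

end Configurations

/-! ### The ring generated by connected counting terms -/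

section ConnectedRing

theorem image_append {n p : ℕ} (u : Fin n → ℕ) (z : Fin p → ℕ) :
    Finset.univ.image (Fin.append u z) = Finset.univ.image u ∪ Finset.univ.image z := by
  ext v
  simp only [Finset.mem_image, Finset.mem_univ, true_and, Finset.mem_union]
  refine ⟨fun ⟨i, hi⟩ => ?_, ?_⟩
  · induction i using Fin.addCases with
    | left i => exact .inl ⟨i, by simpa using hi⟩
    | right i => exact .inr ⟨i, by simpa using hi⟩
  · rintro (⟨i, rfl⟩ | ⟨i, rfl⟩)
    exacts [⟨Fin.castAdd p i, by simp⟩, ⟨Fin.natAdd n i, by simp⟩]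

variable {R r m : ℕ} {V : Set ℕ} {Z S S₁ S₂ : Finset ℕ} {G : SimpleGraph ℕ} {ψ : Formula L P}
  {Q₁ Q₂ : Property L} {N : Subring (Quantity L)}

theorem IsLocalAround.dependsOn_property (hψ : IsLocalAround r S ψ) (A : FinStructure L) :
    DependsOn (ψ.property A) S :=
  (dependsOn_realize hψ.isFO).mono (by exact_mod_cast hψ.free_subset)

theorem count_mul_count_distPattern (hd : Disjoint S₁ S₂) (hG : ∀ i ∈ S₁, ∀ j ∈ S₂, ¬ G.Adj i j)
    (hQ₁ : ∀ A, DependsOn (Q₁ A) S₁) (hQ₂ : ∀ A, DependsOn (Q₂ A) S₂) (Z : Finset ℕ) :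
    count (S₁ ∩ Z) (Q₁ ⊓ distPattern L R S₁ G) * count (S₂ ∩ Z) (Q₂ ⊓ distPattern L R S₂ G) =
      ∑ E ∈ (S₁ ×ˢ S₂).powerset,
        count ((S₁ ∪ S₂) ∩ Z) (Q₁ ⊓ Q₂ ⊓ distPattern L R (S₁ ∪ S₂) (addEdges G E)) := by
  have hdep {S : Finset ℕ} {Q : Property L} (hQ : ∀ A, DependsOn (Q A) S) (A : FinStructure L) :
      DependsOn ((Q ⊓ distPattern L R S G) A) S := fun _ _ h =>
    congrArg₂ And (hQ A h) (dependsOn_distPattern R S G A h)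
  rw [count_mul hd Finset.inter_subset_left Finset.inter_subset_left (hdep hQ₁) (hdep hQ₂),
    ← Finset.union_inter_distrib_right, count_eq_sum_fiber _ _ (closePairs L R S₁ S₂)
      fun A γ => Finset.mem_powerset.2 (Finset.filter_subset _ _)]
  refine Finset.sum_congr rfl fun E hE => ?_
  rw [distPattern_union_addEdges hd hG (Finset.mem_powerset.1 hE), inf_inf_inf_comm, inf_assoc]

theorem exists_property_inf_distPattern_eq [L.IsRelational] [Finite (Σ n, L.Relations n)]
    (h₁ : S₁.Nonempty) (h₂ : S₂.Nonempty) (hG : ∀ i ∈ S₁, ∀ j ∈ S₂, ¬ G.Adj i j)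
    (hd : Disjoint S₁ S₂) (hψ : IsLocalAround r (S₁ ∪ S₂) ψ) :
    ∃ s : Finset (Formula L P × Formula L P),
      (∀ p ∈ s, IsLocalAround r S₁ p.1 ∧ IsLocalAround r S₂ p.2) ∧
      ψ.property ⊓ distPattern L (2 * r + 1) (S₁ ∪ S₂) G =
        s.sup (fun p => p.1.property ⊓ p.2.property) ⊓ distPattern L (2 * r + 1) (S₁ ∪ S₂) G := by
  classical
  obtain ⟨l, hl, hsplit⟩ := hψ.exists_split h₁ h₂
  refine ⟨l.toFinset, fun p hp => hl p (List.mem_toFinset.1 hp), funext fun A => funext fun β => ?_⟩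
  simp only [Pi.inf_apply, Finset.sup_eq_iSup, iSup_apply, iSup_Prop_eq, exists_prop,
    List.mem_toFinset, inf_Prop_eq, eq_iff_iff]
  refine and_congr_left fun hc => hsplit A β fun i hi j hj h => hG i hi j hj ?_
  exact (((distPattern_union_iff hd A β).1 hc).2.2 i hi j hj).2 h

variable [L.IsRelational] [Finite (Σ n, L.Relations n)]

variable (L P) in
/-- The ring of quantities generated by the values of the connected counting terms. -/
def connectedRing (r m : ℕ) (V : Set ℕ) : Subring (Quantity L) :=
  Subring.closure (Term.quantity '' {t : Term L P | IsConnectedCount r m V t})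

theorem exists_isCombination_of_mem_connectedRing {F : Quantity L}
    (hF : F ∈ connectedRing L P r m V) :
    ∃ t : Term L P, t.quantity = F ∧
      IsCombination (fun t => (t = .int 0 ∨ t = .int (-1)) ∨ IsConnectedCount r m V t) t := by
  have hminus : IsCombination
      (fun t : Term L P => (t = .int 0 ∨ t = .int (-1)) ∨ IsConnectedCount r m V t) (.int (-1)) :=
    .base (.inl (.inr rfl))
  induction hF using Subring.closure_induction with
  | mem F hF =>
    obtain ⟨t, ht, rfl⟩ := hF
    exact ⟨t, rfl, .base (.inr ht)⟩
  | zero => exact ⟨.int 0, by ext; simp [Term.quantity, Term.eval], .base (.inl (.inl rfl))⟩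
  | one =>
    exact ⟨.mul (.int (-1)) (.int (-1)), by ext; simp [Term.quantity, Term.eval],
      .mul hminus hminus⟩
  | add F F' _ _ ih ih' =>
    obtain ⟨t, rfl, ht⟩ := ih
    obtain ⟨t', rfl, ht'⟩ := ih'
    exact ⟨.add t t', by ext; simp [Term.quantity, Term.eval], .add ht ht'⟩
  | neg F _ ih =>
    obtain ⟨t, rfl, ht⟩ := ih
    exact ⟨.mul (.int (-1)) t, by ext; simp [Term.quantity, Term.eval], .mul hminus ht⟩
  | mul F F' _ _ ih ih' =>
    obtain ⟨t, rfl, ht⟩ := ih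
    obtain ⟨t', rfl, ht'⟩ := ih'
    exact ⟨.mul t t', by ext; simp [Term.quantity, Term.eval], .mul ht ht'⟩

theorem exists_isConnectedCount_quantity_eq (hZ : Z.card ≤ m) (hSV : (S : Set ℕ) \ Z ⊆ V)
    (hψ : IsLocalAround r S ψ) (hG : (G.induce (S : Set ℕ)).Connected) :
    ∃ t : Term L P, IsConnectedCount r m V t ∧
      t.quantity = count (S ∩ Z) (ψ.property ⊓ distPattern L (2 * r + 1) S G) := by
  let u : Fin (S \ Z).card ↪ ℕ := ((S \ Z).orderEmbOfFin rfl).toEmbedding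
  let z' : Fin (S ∩ Z).card ↪ ℕ := ((S ∩ Z).orderEmbOfFin rfl).toEmbedding
  have hu : Set.range u = (S \ Z : Finset ℕ) := Finset.range_orderEmbOfFin _ _
  have hz' : Finset.univ.image z' = S ∩ Z := Finset.coe_injective (by simp [z'])
  have himage : Finset.univ.image (Fin.append u z') = S := by
    rw [image_append, hz', show Finset.univ.image u = S \ Z from Finset.coe_injective (by simp [u]),
      Finset.sdiff_union_inter]
  have hinj : Function.Injective (Fin.append u z') := by
    refine Fin.append_injective_iff.2 ⟨u.injective, z'.injective, fun i j h => ?_⟩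
    have hi : u i ∈ S \ Z := Finset.orderEmbOfFin_mem _ rfl i
    have hj : z' j ∈ S ∩ Z := Finset.orderEmbOfFin_mem _ rfl j
    grind
  have hrange : Set.range (Fin.append u z') = S := by simp [← himage]
  have hconn : (G.comap (Fin.append u z')).Connected := by
    refine (SimpleGraph.Embedding.comap ⟨_, hinj⟩ G).isoInduceRange.connected_iff.2 ?_
    rw [← hrange] at hG
    exact hG
  have hpos : 0 < (S \ Z).card + (S ∩ Z).card := by
    rw [Finset.card_sdiff_add_card_inter, Finset.card_pos]
    exact Finset.coe_nonempty.1 (Set.nonempty_coe_sort.1 hG.nonempty)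
  refine ⟨.count z' (.and ψ (.delta (G.comap (Fin.append u z')) (2 * r + 1) (Fin.append u z'))),
    ⟨_, _, u, z', _, ψ, (Finset.card_le_card Finset.inter_subset_right).trans hZ, ?_, hinj, hconn,
      hψ.isFO, ?_, rfl⟩, ?_⟩
  · simpa [hu] using hSV
  · rwa [isLocal_iff_isLocalAround hpos hψ.isFO hinj, himage]
  · rw [quantity_count, property_and, property_delta hinj, himage, hz']

/-- Feferman–Vaught splits `ψ` into a disjunction, inclusion–exclusion reduces to one disjunct, and
that count is a product minus the counts with additional edges across. -/
theorem count_mem_of_split (hne₁ : S₁.Nonempty) (hne₂ : S₂.Nonempty) (hd : Disjoint S₁ S₂)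
    (hG : ∀ i ∈ S₁, ∀ j ∈ S₂, ¬ G.Adj i j)
    (h₁ : ∀ α : Formula L P, IsLocalAround r S₁ α →
      count (S₁ ∩ Z) (α.property ⊓ distPattern L (2 * r + 1) S₁ G) ∈ N)
    (h₂ : ∀ α : Formula L P, IsLocalAround r S₂ α →
      count (S₂ ∩ Z) (α.property ⊓ distPattern L (2 * r + 1) S₂ G) ∈ N)
    (hE : ∀ E ⊆ S₁ ×ˢ S₂, E.Nonempty → ∀ α : Formula L P, IsLocalAround r (S₁ ∪ S₂) α →
      count ((S₁ ∪ S₂) ∩ Z)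
        (α.property ⊓ distPattern L (2 * r + 1) (S₁ ∪ S₂) (addEdges G E)) ∈ N)
    (hψ : IsLocalAround r (S₁ ∪ S₂) ψ) :
    count ((S₁ ∪ S₂) ∩ Z) (ψ.property ⊓ distPattern L (2 * r + 1) (S₁ ∪ S₂) G) ∈ N := by
  classical
  have hpair : ∀ α χ : Formula L P, IsLocalAround r S₁ α → IsLocalAround r S₂ χ →
      count ((S₁ ∪ S₂) ∩ Z)
        (α.property ⊓ χ.property ⊓ distPattern L (2 * r + 1) (S₁ ∪ S₂) G) ∈ N := by
    intro α χ hα hχ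
    have heq := count_mul_count_distPattern (R := 2 * r + 1) hd hG hα.dependsOn_property
      hχ.dependsOn_property Z
    rw [← Finset.add_sum_erase _ _ (Finset.empty_mem_powerset _), addEdges_empty,
      ← sub_eq_iff_eq_add] at heq
    rw [← heq]
    refine N.sub_mem (N.mul_mem (h₁ α hα) (h₂ χ hχ)) (N.sum_mem fun E hE' => ?_)
    rw [Finset.mem_erase, ← Finset.nonempty_iff_ne_empty, Finset.mem_powerset] at hE'
    rw [← property_and]
    exact hE E hE'.2 hE'.1 _ ((hα.mono hne₁ Finset.subset_union_left).and
      (hχ.mono hne₂ Finset.subset_union_right))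
  obtain ⟨s, hs, heq⟩ := exists_property_inf_distPattern_eq hne₁ hne₂ hG hd hψ
  rw [heq]
  refine map_finsetSup_mem (N := N.toAddSubgroup)
    (f := fun Q => count ((S₁ ∪ S₂) ∩ Z) (Q ⊓ distPattern L (2 * r + 1) (S₁ ∪ S₂) G))
    (C := {Q | ∃ α χ : Formula L P, IsLocalAround r S₁ α ∧ IsLocalAround r S₂ χ ∧
      α.property ⊓ χ.property = Q})
    ?_ (fun Q Q' => ?_) ?_ ?_ s fun p hp => ⟨p.1, p.2, (hs p hp).1, (hs p hp).2, rfl⟩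
  · simp [count_bot]
  · rw [inf_sup_right, count_sup, ← inf_inf_distrib_right]
  · rintro _ ⟨α, χ, hα, hχ, rfl⟩ _ ⟨α', χ', hα', hχ', rfl⟩
    exact ⟨α.and α', χ.and χ', hα.and hα', hχ.and hχ', by
      rw [property_and, property_and, inf_inf_inf_comm]⟩
  · rintro _ ⟨α, χ, hα, hχ, rfl⟩
    exact hpair α χ hα hχ

theorem count_mem_connectedRing (hZ : Z.card ≤ m) (hS : S.Nonempty) (hSV : (S : Set ℕ) \ Z ⊆ V)
    (hψ : IsLocalAround r S ψ) :
    count (S ∩ Z) (ψ.property ⊓ distPattern L (2 * r + 1) S G) ∈ connectedRing L P r m V := by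
  induction hk : (nonEdges S G).card using Nat.strong_induction_on generalizing S G ψ with
  | _ k ih =>
  subst hk
  by_cases hconn : (G.induce (S : Set ℕ)).Connected
  · obtain ⟨t, ht, heq⟩ := exists_isConnectedCount_quantity_eq hZ hSV hψ hconn
    exact heq ▸ Subring.subset_closure (Set.mem_image_of_mem _ ht)
  obtain ⟨S₁, S₂, hne₁, hne₂, hd, rfl, hG⟩ := exists_split_of_not_connected hS hconn
  have hsub {S' : Finset ℕ} (h : S' ⊂ S₁ ∪ S₂) (hne : S'.Nonempty) (α : Formula L P)
      (hα : IsLocalAround r S' α) :=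
    ih _ (card_nonEdges_lt_of_ssubset h) hne
      ((Set.sdiff_subset_sdiff_left (by exact_mod_cast h.1)).trans hSV) hα rfl
  refine count_mem_of_split hne₁ hne₂ hd hG (hsub ?_ hne₁) (hsub ?_ hne₂)
    (fun E hE hne α hα => ?_) hψ
  · refine Finset.ssubset_iff_subset_ne.2 ⟨Finset.subset_union_left, fun h => ?_⟩
    exact hne₂.ne_empty (hd.eq_bot_of_ge (h ▸ Finset.subset_union_right))
  · refine Finset.ssubset_iff_subset_ne.2 ⟨Finset.subset_union_right, fun h => ?_⟩
    exact hne₁.ne_empty (hd.eq_bot_of_le (h ▸ Finset.subset_union_left))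
  · exact ih _ (card_nonEdges_addEdges_lt hd hG hE hne) hS hSV hα rfl

theorem exists_isCombination_quantity_eq {n p : ℕ} {u : Fin n → ℕ} {z : Fin p ↪ ℕ}
    (hpos : 0 < n + p) (hinj : Function.Injective (Fin.append u z)) (hψ : ψ.IsFO)
    (hloc : IsLocal r ψ (Fin.append u z)) (H : SimpleGraph (Fin (n + p))) :
    ∃ t : Term L P,
      IsCombination (fun t => (t = .int 0 ∨ t = .int (-1)) ∨ IsConnectedCount r p (Set.range u) t)
        t ∧
      (Term.count z (ψ.and (.delta H (2 * r + 1) (Fin.append u z)))).quantity = t.quantity := by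
  have hZ : (Finset.univ.image z).card ≤ p := Finset.card_image_le.trans (by simp)
  have hS : (Finset.univ.image (Fin.append u z)).Nonempty :=
    ⟨_, Finset.mem_image_of_mem _ (Finset.mem_univ ⟨0, hpos⟩)⟩
  have hSV : (Finset.univ.image (Fin.append u z) : Set ℕ) \ Finset.univ.image z ⊆ Set.range u := by
    rw [image_append, Finset.coe_union, Set.union_sdiff_right]
    exact Set.sdiff_subset.trans (by simp)
  have hSZ : Finset.univ.image (Fin.append u z) ∩ Finset.univ.image z = Finset.univ.image z := by
    rw [image_append, Finset.inter_eq_right]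
    exact Finset.subset_union_right
  obtain ⟨t, heq, ht⟩ := exists_isCombination_of_mem_connectedRing <|
    count_mem_connectedRing (G := H.map (Fin.append u z)) hZ hS hSV
      ((isLocal_iff_isLocalAround hpos hψ hinj).1 hloc)
  refine ⟨t, ht, heq ▸ ?_⟩
  have hdelta := property_delta (L := L) (P := P) (R := 2 * r + 1)
    (G := H.map (Fin.append u z)) hinj
  rw [show (H.map (Fin.append u z)).comap (Fin.append u z) = H from
    SimpleGraph.comap_map_eq ⟨_, hinj⟩ H] at hdelta
  rw [quantity_count, property_and, hdelta, hSZ]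

end ConnectedRing

/-! ### Sizes of balls, and distances along connected graphs -/

section Graphs

variable {V W : Type*} {G : SimpleGraph V} {d : ℕ}

theorem exists_adj_of_edist_eq_succ {a b : V} {i : ℕ} (h : G.edist a b = (i + 1 : ℕ)) :
    ∃ c, G.edist a c = i ∧ G.Adj c b := by
  obtain ⟨p, hp⟩ := SimpleGraph.exists_walk_of_edist_eq_coe h
  have hadj : G.Adj p.penultimate b := p.adj_penultimate <| by
    simp [← SimpleGraph.Walk.length_eq_zero_iff, hp]
  have htri : G.edist a b ≤ G.edist a p.penultimate + G.edist p.penultimate b :=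
    SimpleGraph.edist_triangle
  rw [h, SimpleGraph.edist_eq_one_iff_adj.2 hadj] at htri
  refine ⟨p.penultimate, le_antisymm ?_ ?_, hadj⟩
  · simpa [hp] using p.dropLast.edist_le
  · exact (ENat.add_le_add_iff_right ENat.one_ne_top).1 (by exact_mod_cast htri)

theorem ncard_sphere_le [Finite V] (hd : ∀ v, (G.neighborSet v).ncard ≤ d) (a : V) (i : ℕ) :
    {b | G.edist a b = (i + 1 : ℕ)}.ncard ≤ d * (d - 1) ^ i := by
  induction i with
  | zero =>
    refine (Set.ncard_le_ncard fun b hb => ?_).trans ((hd a).trans_eq (by simp))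
    exact SimpleGraph.edist_eq_one_iff_adj.1 (by simpa using hb)
  | succ i ih =>
    let sphere (j : ℕ) : Set V := {b | G.edist a b = j}
    have hfin : (sphere (i + 1)).Finite := Set.toFinite _
    have hcover : sphere (i + 1 + 1) ⊆
        ⋃ c ∈ hfin.toFinset, G.neighborSet c ∩ sphere (i + 1 + 1) := fun b hb => by
      obtain ⟨c, hc, hcb⟩ := exists_adj_of_edist_eq_succ hb
      exact Set.mem_biUnion (hfin.mem_toFinset.2 hc) ⟨hcb, hb⟩
    have hchildren : ∀ c ∈ hfin.toFinset,
        (G.neighborSet c ∩ sphere (i + 1 + 1)).ncard ≤ d - 1 := fun c hc => by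
      obtain ⟨c', hc', hadj⟩ := exists_adj_of_edist_eq_succ (hfin.mem_toFinset.1 hc)
      refine Nat.le_sub_one_of_lt ((Set.ncard_lt_ncard ?_).trans_le (hd c))
      refine ⟨Set.inter_subset_left, fun h => ?_⟩
      have h : G.edist a c' = (i + 1 + 1 : ℕ) := (h hadj.symm).2
      rw [hc', Nat.cast_inj] at h
      omega
    calc (sphere (i + 1 + 1)).ncard
        ≤ (⋃ c ∈ hfin.toFinset, G.neighborSet c ∩ sphere (i + 1 + 1)).ncard :=
          Set.ncard_le_ncard hcover
      _ ≤ ∑ c ∈ hfin.toFinset, (G.neighborSet c ∩ sphere (i + 1 + 1)).ncard :=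
          Finset.set_ncard_biUnion_le _ _
      _ ≤ (sphere (i + 1)).ncard * (d - 1) := by
          rw [Set.ncard_eq_toFinset_card _ hfin]
          exact Finset.sum_le_card_nsmul _ _ _ hchildren
      _ ≤ d * (d - 1) ^ i * (d - 1) := Nat.mul_le_mul_right _ ih
      _ = d * (d - 1) ^ (i + 1) := by ring

theorem ncard_closedBall_le_nu [Finite V] (hd : ∀ v, (G.neighborSet v).ncard ≤ d) (a : V)
    (R : ℕ) : {b | G.edist a b ≤ R}.ncard ≤ nu d R := by
  induction R with
  | zero => simp [nu]
  | succ R ih =>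
    have hsub : {b | G.edist a b ≤ (R + 1 : ℕ)} ⊆
        {b | G.edist a b ≤ R} ∪ {b | G.edist a b = (R + 1 : ℕ)} := fun b hb => by
      rcases le_or_gt (G.edist a b) R with h | h
      · exact .inl h
      · exact .inr (le_antisymm hb (by exact_mod_cast Order.add_one_le_of_lt h))
    calc {b | G.edist a b ≤ (R + 1 : ℕ)}.ncard
        ≤ {b | G.edist a b ≤ R}.ncard + {b | G.edist a b = (R + 1 : ℕ)}.ncard :=
          (Set.ncard_le_ncard hsub).trans (Set.ncard_union_le _ _)
      _ ≤ nu d R + d * (d - 1) ^ R := Nat.add_le_add ih (ncard_sphere_le hd a R)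
      _ = nu d (R + 1) := by simp only [nu, Finset.sum_range_succ]; ring

theorem ncard_ball_le {A : Type} [Finite A] [L.Structure A] {l : ℕ} (w : Fin l → A) (R : ℕ) :
    (ball L R w).ncard ≤ l * nu (degree L A) R := by
  have hdeg (a : A) : ((gaifman L A).neighborSet a).ncard ≤ degree L A :=
    le_ciSup (f := fun a => ((gaifman L A).neighborSet a).ncard) (Set.finite_range _).bddAbove a
  have hball : ball L R w = ⋃ j, {b | (gaifman L A).edist (w j) b ≤ R} := by ext b; simp [ball]
  rw [hball]
  refine (Set.ncard_iUnion_le_of_fintype _).trans ?_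
  exact (Finset.sum_le_card_nsmul _ _ _ fun j _ => ncard_closedBall_le_nu hdeg (w j) R).trans_eq
    (by simp)

theorem exists_dist_le_card_compl [Fintype V] [DecidableEq V] (hG : G.Connected) {X : Finset V}
    (hX : X.Nonempty) (j : V) : ∃ i ∈ X, G.dist j i ≤ Xᶜ.card := by
  obtain ⟨i, hi, hmin⟩ := X.exists_min_image (G.dist j) hX
  obtain ⟨p, hp⟩ := hG.exists_walk_length_eq_dist j i
  refine ⟨i, hi, ?_⟩
  rw [← Finset.card_range (G.dist j i)]
  -- A shortest path from `j` to `X` meets `X` only at its end.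
  refine Finset.card_le_card_of_injOn p.getVert (fun t ht => ?_) fun t ht t' ht' h => ?_
  · have ht : t < G.dist j i := by simpa using ht
    refine Finset.mem_coe.2 (Finset.mem_compl.2 fun hX => ?_)
    have h₁ := hmin _ hX
    have h₂ := SimpleGraph.dist_le (p.take t)
    rw [SimpleGraph.Walk.take_length] at h₂
    omega
  · rw [Finset.coe_range, Set.mem_Iio, ← hp] at ht ht'
    exact (p.isPath_of_length_eq_dist hp).getVert_injOn ht.le ht'.le h

theorem edist_le_mul_length {H : SimpleGraph W} {f : W → V} {R : ℕ}
    (hf : ∀ i j, H.Adj i j → G.edist (f i) (f j) ≤ R) {i j : W} (p : H.Walk i j) :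
    G.edist (f i) (f j) ≤ (R * p.length : ℕ) := by
  induction p with
  | nil => simp
  | cons h p ih =>
    refine SimpleGraph.edist_triangle.trans ((add_le_add (hf _ _ h) ih).trans_eq ?_)
    rw [SimpleGraph.Walk.length_cons]
    push_cast
    ring

theorem exists_edist_le_mul_card_compl [Fintype W] [DecidableEq W] {H : SimpleGraph W}
    (hH : H.Connected) {f : W → V} {R : ℕ} (hf : ∀ i j, H.Adj i j → G.edist (f i) (f j) ≤ R)
    {X : Finset W} (hX : X.Nonempty) (j : W) :
    ∃ i ∈ X, G.edist (f i) (f j) ≤ (R * Xᶜ.card : ℕ) := by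
  obtain ⟨i, hi, hij⟩ := exists_dist_le_card_compl hH hX j
  obtain ⟨p, hp⟩ := hH.exists_walk_length_eq_dist j i
  refine ⟨i, hi, ?_⟩
  rw [SimpleGraph.edist_comm]
  refine (edist_le_mul_length hf p).trans ?_
  gcongr
  exact hp.trans_le hij

theorem exists_edist_le_of_realize_delta [Finite (Σ n, L.Relations n)] {A : Type} [L.Structure A]
    {n R : ℕ} {H : SimpleGraph (Fin n)} (hH : H.Connected) {e : Fin n → ℕ}
    (he : Function.Injective e) {γ : ℕ → A} (h : (Formula.delta H R e : Formula L P).Realize γ)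
    {U : Finset ℕ} (hU : (Finset.univ.image e ∩ U).Nonempty) (j : Fin n) :
    ∃ v ∈ Finset.univ.image e ∩ U, (gaifman L A).edist (γ v) (γ (e j)) ≤
      (R * (Finset.univ.image e \ U).card : ℕ) := by
  let X : Finset (Fin n) := {i | e i ∈ U}
  have himage : Finset.univ.image e \ U = Xᶜ.image e := by ext v; simp [X]; grind
  have hX : X.Nonempty := by
    obtain ⟨v, hv⟩ := hU
    obtain ⟨hv, hvU⟩ := Finset.mem_inter.1 hv
    obtain ⟨i, -, rfl⟩ := Finset.mem_image.1 hv
    exact ⟨i, by simpa [X] using hvU⟩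
  rw [realize_delta] at h
  obtain ⟨i, hi, hij⟩ := exists_edist_le_mul_card_compl hH (f := γ ∘ e)
    (fun a b hab => (h a b hab.ne).1 hab) hX j
  rw [himage, Finset.card_image_of_injective _ he]
  exact ⟨e i, by simpa [X] using hi, hij⟩

end Graphs

/-! ### Evaluating connected counting terms -/

section ConnectedCount

variable {A : Type} [L.Structure A]

theorem dependsOn_eval_count {p : ℕ} (z : Fin p ↪ ℕ) {φ : Formula L P} (hφ : φ.IsFO) :
    DependsOn (fun β : ℕ → A => (Term.count z φ).eval β) (Term.count z φ).free := by
  intro β β' h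
  have hrealize (a : Fin p → A) : φ.Realize (Function.extend z a β) =
      φ.Realize (Function.extend z a β') := dependsOn_realize hφ fun v hv => by
    by_cases hz : ∃ j, z j = v
    · obtain ⟨j, rfl⟩ := hz
      simp only [z.injective.extend_apply]
    · rw [Function.extend_apply' _ _ _ hz, Function.extend_apply' _ _ _ hz]
      exact h v (by simpa [Term.free, hz] using hv)
  simp only [Term.eval, hrealize]

variable [Finite (Σ n, L.Relations n)] {n p r R m : ℕ} {u : Fin n → ℕ} {z : Fin p ↪ ℕ}
  {H : SimpleGraph (Fin (n + p))} {ψ : Formula L P} {β : ℕ → A} {V : Set ℕ} {t : Term L P}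

theorem exists_edist_le_of_realize_extend (hinj : Function.Injective (Fin.append u z))
    (hH : H.Connected) {a : Fin p → A} (ha : (ψ.and (.delta H R (Fin.append u z))).Realize
      (Function.extend z a β)) {U : Finset ℕ} (hU : U.Nonempty) (hUu : U ⊆ Finset.univ.image u)
    (j : Fin (n + p)) : ∃ v ∈ U, (gaifman L A).edist (β v)
      (Function.extend z a β (Fin.append u z j)) ≤
        (R * ((Finset.univ.image u \ U).card + p) : ℕ) := by
  have hinter : Finset.univ.image (Fin.append u z) ∩ U = U := by
    rw [image_append]
    exact Finset.inter_eq_right.2 (hUu.trans Finset.subset_union_left)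
  have hcard : (Finset.univ.image (Fin.append u z) \ U).card ≤
      (Finset.univ.image u \ U).card + p := by
    rw [image_append, Finset.union_sdiff_distrib]
    refine (Finset.card_union_le _ _).trans (Nat.add_le_add_left ?_ _)
    exact (Finset.card_le_card Finset.sdiff_subset).trans (Finset.card_image_le.trans (by simp))
  obtain ⟨v, hv, hle⟩ := exists_edist_le_of_realize_delta hH hinj ((realize_and _ _ _).1 ha).2
    (hinter.symm ▸ hU) j
  rw [hinter] at hv
  obtain ⟨i, -, rfl⟩ := Finset.mem_image.1 (hUu hv)
  rw [Function.extend_apply' _ _ _ fun ⟨q, hq⟩ =>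
    (Fin.append_injective_iff.1 hinj).2.2 i q hq.symm] at hle
  exact ⟨u i, hv, hle.trans (by gcongr)⟩

theorem eval_connectedCount_eq_zero (hinj : Function.Injective (Fin.append u z))
    (hH : H.Connected) {U : Finset ℕ} (hU : U.Nonempty) (hUu : U ⊆ Finset.univ.image u)
    {K : ℕ} (hK : (Finset.univ.image u \ U).card + p ≤ K) (j : Fin n)
    (hfar : ∀ v ∈ U, ¬ (gaifman L A).edist (β v) (β (u j)) ≤ (R * K : ℕ)) :
    (Term.count z (ψ.and (.delta H R (Fin.append u z)))).eval β = 0 := by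
  have : IsEmpty {a : Fin p → A // (ψ.and (.delta H R (Fin.append u z))).Realize
      (Function.extend z a β)} := by
    refine ⟨fun ⟨a, ha⟩ => ?_⟩
    obtain ⟨v, hv, hle⟩ := exists_edist_le_of_realize_extend hinj hH ha hU hUu (Fin.castAdd p j)
    rw [Fin.append_left, Function.extend_apply' _ _ _ fun ⟨q, hq⟩ =>
      (Fin.append_injective_iff.1 hinj).2.2 j q hq.symm] at hle
    exact hfar v hv (hle.trans (by gcongr))
  simp only [Term.eval, Nat.card_of_isEmpty, Nat.cast_zero]

theorem eval_connectedCount_le [Finite A] (hn : 0 < n)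
    (hinj : Function.Injective (Fin.append u z)) (hH : H.Connected) :
    (Term.count z (ψ.and (.delta H R (Fin.append u z)))).eval β ≤
      ((ball L (R * p) (β ∘ u)).ncard ^ p : ℕ) := by
  have hne : (Finset.univ.image u).Nonempty := ⟨u ⟨0, hn⟩, Finset.mem_image_of_mem _ (by simp)⟩
  have hmem (a : Fin p → A) (ha : (ψ.and (.delta H R (Fin.append u z))).Realize
      (Function.extend z a β)) (i : Fin p) : a i ∈ ball L (R * p) (β ∘ u) := by
    obtain ⟨v, hv, hle⟩ := exists_edist_le_of_realize_extend hinj hH ha hne subset_rfl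
      (Fin.natAdd n i)
    obtain ⟨j, -, rfl⟩ := Finset.mem_image.1 hv
    rw [Fin.append_right, z.injective.extend_apply] at hle
    exact ⟨j, by simpa using hle⟩
  simp only [Term.eval, Nat.cast_le]
  calc _ ≤ Nat.card (Fin p → ball L (R * p) (β ∘ u)) :=
        Nat.card_le_card_of_injective (fun a i => ⟨a.1 i, hmem a.1 a.2 i⟩) fun a b h =>
          Subtype.ext (funext fun i => congrArg Subtype.val (congrFun h i))
    _ = (ball L (R * p) (β ∘ u)).ncard ^ p := by
        rw [Nat.card_fun, Nat.card_fin, Nat.card_coe_set_eq]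

theorem free_connectedCount_subset (hψ : (ψ.free : Set ℕ) ⊆ Set.range (Fin.append u z)) :
    (Term.count z (ψ.and (.delta H R (Fin.append u z)))).free ⊆ Finset.univ.image u := by
  have hψ' : ψ.free ⊆ Finset.univ.image u ∪ Finset.univ.image z := by
    rw [← image_append, ← Finset.coe_subset]
    simpa using hψ
  have hδ := Formula.free_delta_subset (L := L) (P := P) H R (Fin.append u z)
  rw [image_append] at hδ
  rw [Term.free, Formula.free_and]
  exact sdiff_le_iff'.2 (Finset.union_subset hψ' hδ)

namespace IsConnectedCount

variable [L.IsRelational]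

theorem isFOC1 (ht : IsConnectedCount r m V t) : t.IsFOC1 := by
  obtain ⟨n, p, u, z, H, ψ, -, -, -, -, hψ, -, rfl⟩ := ht
  exact (hψ.and (Formula.isFO_delta _ _ _)).isFOC1

theorem free_subset (ht : IsConnectedCount r m V t) : (t.free : Set ℕ) ⊆ V := by
  obtain ⟨n, p, u, z, H, ψ, -, hu, -, -, -, hloc, rfl⟩ := ht
  exact (Finset.coe_subset.2 (free_connectedCount_subset hloc.1)).trans (by simpa using hu)

theorem dependsOn_eval (ht : IsConnectedCount r m V t) :
    DependsOn (fun β : ℕ → A => t.eval β) t.free := by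
  obtain ⟨n, p, u, z, H, ψ, -, -, -, -, hψ, -, rfl⟩ := ht
  exact dependsOn_eval_count z (hψ.and (Formula.isFO_delta _ _ _))

end IsConnectedCount

end ConnectedCount

/-! ### Replacing the combination by one that ignores far positions -/

section Replacement

variable {A : Type} [L.Structure A] {V : Set ℕ} {t t' : Term L P} {B B' : Term L P → Prop}
  {rel : (ℕ → A) → (ℕ → A) → Prop}

/-- `t'` is at most as large as `t`, and its value at `β'` is that of `t` at `β` whenever
`rel β β'`. -/
def IsReplacement (rel : (ℕ → A) → (ℕ → A) → Prop) (t t' : Term L P) : Prop :=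
  t'.size ≤ t.size ∧ ∀ β β', rel β β' → t.eval β = t'.eval β'

theorem isReplacement_int (c : ℤ) : IsReplacement rel (.int c : Term L P) (.int c) :=
  ⟨le_rfl, fun _ _ _ => by simp only [Term.eval]⟩

theorem IsCombination.exists_isReplacement (h : ∀ t, B t → ∃ t', B' t' ∧ IsReplacement rel t t')
    (ht : IsCombination B t) : ∃ t', IsCombination B' t' ∧ IsReplacement rel t t' := by
  induction ht with
  | base ht =>
    obtain ⟨t', ht', hrep⟩ := h _ ht
    exact ⟨t', .base ht', hrep⟩
  | add _ _ ih₁ ih₂ =>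
    obtain ⟨t₁, h₁, hsize₁, heval₁⟩ := ih₁
    obtain ⟨t₂, h₂, hsize₂, heval₂⟩ := ih₂
    exact ⟨.add t₁ t₂, .add h₁ h₂, by simp only [Term.size]; omega, fun β β' hβ => by
      simp only [Term.eval, heval₁ β β' hβ, heval₂ β β' hβ]⟩
  | mul _ _ ih₁ ih₂ =>
    obtain ⟨t₁, h₁, hsize₁, heval₁⟩ := ih₁
    obtain ⟨t₂, h₂, hsize₂, heval₂⟩ := ih₂
    exact ⟨.mul t₁ t₂, .mul h₁ h₂, by simp only [Term.size]; omega, fun β β' hβ => by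
      simp only [Term.eval, heval₁ β β' hβ, heval₂ β β' hβ]⟩

theorem IsCombination.isFOC1 (h : ∀ t, B t → t.IsFOC1) (ht : IsCombination B t) : t.IsFOC1 := by
  induction ht with
  | base ht => exact h _ ht
  | add _ _ ih₁ ih₂ => simp [Term.IsFOC1, ih₁, ih₂]
  | mul _ _ ih₁ ih₂ => simp [Term.IsFOC1, ih₁, ih₂]

theorem IsCombination.free_subset (h : ∀ t, B t → (t.free : Set ℕ) ⊆ V)
    (ht : IsCombination B t) : (t.free : Set ℕ) ⊆ V := by
  induction ht with
  | base ht => exact h _ ht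
  | add _ _ ih₁ ih₂ => simp [Term.free, ih₁, ih₂]
  | mul _ _ ih₁ ih₂ => simp [Term.free, ih₁, ih₂]

/-- The valuation `β` maps `(x, y)` to some `(vᵢ, w)`, and `β'` maps it to `(vᵢ, w')` where `w'`
agrees with `w` at the entries in `N`. -/
def IsShift {s k l : ℕ} (x : Fin k → ℕ) (y : Fin l → ℕ) (v : Fin s → Fin k → A) (w : Fin l → A)
    (N : Set A) (β β' : ℕ → A) : Prop :=
  ∃ (i : Fin s) (w' : Fin l → A), AgreeOn N w w' ∧
    (∀ j, β (Fin.append x y j) = Fin.append (v i) w j) ∧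
    ∀ j, β' (Fin.append x y j) = Fin.append (v i) w' j

variable [L.IsRelational] [Finite (Σ n, L.Relations n)] {s k l r m : ℕ}
  {x : Fin k → ℕ} {y : Fin l → ℕ} {v : Fin s → Fin k → A} {w : Fin l → A} {N : Set A} {b : Fin l}

/-- The base terms of the final combination: integers from `-1` to `c`, and connected counts. -/
def IsBase (r m c : ℕ) (V : Set ℕ) (t : Term L P) : Prop :=
  (∃ i : ℤ, -1 ≤ i ∧ i ≤ (c : ℤ) ∧ t = .int i) ∨ IsConnectedCount r m V t

theorem IsBase.isFOC1 {c : ℕ} (ht : IsBase r m c V t) : t.IsFOC1 := by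
  obtain ⟨i, -, -, rfl⟩ | ht := ht
  exacts [trivial, ht.isFOC1]

theorem IsBase.free_subset {c : ℕ} (ht : IsBase r m c V t) : (t.free : Set ℕ) ⊆ V := by
  obtain ⟨i, -, -, rfl⟩ | ht := ht
  exacts [by simp [Term.free], ht.free_subset]

theorem IsConnectedCount.one_le_size (ht : IsConnectedCount r m V t) : 1 ≤ t.size := by
  obtain ⟨n, p, u, z, H, ψ, -, -, -, -, -, -, rfl⟩ := ht
  simp only [Term.size]
  omega

theorem IsConnectedCount.isReplacement_self
    (ht : IsConnectedCount r m (Set.range (Fin.append x y)) t)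
    (hnear : ∀ j, y j ∈ t.free → w j ∈ N) : IsReplacement (IsShift x y v w N) t t := by
  refine ⟨le_rfl, ?_⟩
  rintro β β' ⟨i, w', hw', hβ, hβ'⟩
  refine ht.dependsOn_eval fun a ha => ?_
  obtain ⟨j, rfl⟩ := ht.free_subset ha
  rw [hβ, hβ']
  induction j using Fin.addCases with
  | left j => simp
  | right j => simpa using hw' j (hnear j (by simpa using ha))

theorem IsConnectedCount.isReplacement_zero
    (ht : IsConnectedCount r m (Set.range (Fin.append x y)) t) {a : Fin k}
    (ha : x a ∈ t.free) (hb : y b ∈ t.free)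
    (hfar : w b ∉ ball L ((2 * r + 1) * (l + m)) fun ij : Fin s × Fin k => v ij.1 ij.2) :
    IsReplacement (IsShift x y v w N) t (.int 0) := by
  classical
  refine ⟨ht.one_le_size, ?_⟩
  rintro β β' ⟨i, w', -, hβ, -⟩
  have hβx (j) : β (x j) = v i j := by simpa using hβ (Fin.castAdd l j)
  have hβy (j) : β (y j) = w j := by simpa using hβ (Fin.natAdd k j)
  obtain ⟨n, p, u, z, H, ψ, hp, hu, hinj, hH, -, hloc, rfl⟩ := ht
  have hfree := free_connectedCount_subset (R := 2 * r + 1) (H := H) hloc.1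
  obtain ⟨j, -, hj⟩ := Finset.mem_image.1 (hfree hb)
  have hcard : (Finset.univ.image u \ (Finset.univ.image u ∩ Finset.univ.image x)).card + p ≤
      l + m := by
    refine Nat.add_le_add ((Finset.card_le_card (t := Finset.univ.image y) fun c hc => ?_).trans
      (Finset.card_image_le.trans (by simp))) hp
    obtain ⟨hcu, hcx⟩ := Finset.mem_sdiff.1 hc
    obtain ⟨i, -, rfl⟩ := Finset.mem_image.1 hcu
    obtain ⟨j, hj⟩ := hu ⟨i, rfl⟩
    rw [← hj] at hcx hcu ⊢
    induction j using Fin.addCases with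
    | left j => simp_all
    | right j => simp
  rw [eval_connectedCount_eq_zero hinj hH ⟨x a, ?_⟩ Finset.inter_subset_left hcard j ?_]
  · simp only [Term.eval]
  · exact Finset.mem_inter.2 ⟨hfree ha, Finset.mem_image_of_mem _ (Finset.mem_univ a)⟩
  · intro c hc hle
    obtain ⟨c, -, rfl⟩ := Finset.mem_image.1 (Finset.mem_inter.1 hc).2
    rw [hj, hβx, hβy] at hle
    exact hfar ⟨(i, c), hle⟩

theorem IsConnectedCount.exists_int_isReplacement [Finite A]
    (hxy : Function.Injective (Fin.append x y))
    (ht : IsConnectedCount r m (Set.range (Fin.append x y)) t)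
    (hfree : (t.free : Set ℕ) ⊆ Set.range y) (hb : y b ∈ t.free) :
    ∃ c : ℤ, 0 ≤ c ∧ c ≤ ((l * nu (degree L A) ((2 * r + 1) * m)) ^ m : ℕ) ∧
      IsReplacement (IsShift x y v w N) t (.int c) := by
  have hy : Function.Injective y := (Fin.append_injective_iff.1 hxy).2.1
  let β₀ : ℕ → A := Function.extend y w fun _ => w b
  refine ⟨t.eval β₀, ?_, ?_, ht.one_le_size, ?_⟩
  · obtain ⟨n, p, u, z, H, ψ, -, -, -, -, -, -, rfl⟩ := ht
    simp only [Term.eval, Nat.cast_nonneg]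
  · obtain ⟨n, p, u, z, H, ψ, hp, -, hinj, hH, -, hloc, rfl⟩ := ht
    obtain ⟨j, -, -⟩ := Finset.mem_image.1
      (free_connectedCount_subset (R := 2 * r + 1) (H := H) hloc.1 hb)
    have hsub : ball L ((2 * r + 1) * p) (β₀ ∘ u) ⊆ ball L ((2 * r + 1) * m) w := by
      rintro a ⟨i, hi⟩
      obtain ⟨j, hj⟩ : ∃ j, w j = β₀ (u i) := by
        by_cases hui : ∃ j, y j = u i
        · exact hui.imp fun j hj => by simp only [β₀, ← hj, hy.extend_apply]
        · exact ⟨b, (Function.extend_apply' _ (fun _ => w b) _ hui).symm⟩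
      exact ⟨j, hj ▸ hi.trans (by gcongr)⟩
    have hpos : 0 < l * nu (degree L A) ((2 * r + 1) * m) := Nat.mul_pos b.pos (by simp [nu])
    refine (eval_connectedCount_le j.pos hinj hH).trans (Nat.cast_le.2 ?_)
    exact (Nat.pow_le_pow_left ((Set.ncard_le_ncard hsub).trans (ncard_ball_le w _)) p).trans
      (Nat.pow_le_pow_right hpos hp)
  · rintro β β' ⟨i, w', -, hβ, -⟩
    simp only [Term.eval]
    refine ht.dependsOn_eval fun c hc => ?_
    obtain ⟨j, rfl⟩ := hfree hc
    simpa [β₀, hy.extend_apply] using hβ (Fin.natAdd k j)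

theorem IsConnectedCount.exists_isReplacement [Finite A]
    (hxy : Function.Injective (Fin.append x y)) (v : Fin s → Fin k → A) (w : Fin l → A)
    (ht : IsConnectedCount r m (Set.range (Fin.append x y)) t) :
    ∃ t' : Term L P, IsBase r m ((l * nu (degree L A) ((2 * r + 1) * m)) ^ m)
        (Set.range (Fin.append x y)) t' ∧
      IsReplacement (IsShift x y v w
        (ball L ((2 * r + 1) * (l + m)) fun ij : Fin s × Fin k => v ij.1 ij.2)) t t' := by
  set N := ball L ((2 * r + 1) * (l + m)) fun ij : Fin s × Fin k => v ij.1 ij.2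
  by_cases hnear : ∀ j, y j ∈ t.free → w j ∈ N
  · exact ⟨t, .inr ht, ht.isReplacement_self hnear⟩
  push Not at hnear
  obtain ⟨b, hb, hfar⟩ := hnear
  by_cases hx : ∃ a, x a ∈ t.free
  · obtain ⟨a, ha⟩ := hx
    exact ⟨.int 0, .inl ⟨0, by simp, by positivity, rfl⟩, ht.isReplacement_zero ha hb hfar⟩
  · have hfree : (t.free : Set ℕ) ⊆ Set.range y := fun c hc => by
      obtain ⟨j, rfl⟩ := ht.free_subset hc
      induction j using Fin.addCases with
      | left j => exact (hx ⟨j, by simpa using hc⟩).elim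
      | right j => exact ⟨j, by simp⟩
    obtain ⟨c, hc₀, hc, hrep⟩ :=
      ht.exists_int_isReplacement (v := v) (w := w) (N := N) hxy hfree hb
    exact ⟨.int c, .inl ⟨c, by omega, hc, rfl⟩, hrep⟩

theorem exists_isBase_isReplacement [Finite A] (hxy : Function.Injective (Fin.append x y))
    (v : Fin s → Fin k → A) (w : Fin l → A)
    (ht : (t = .int 0 ∨ t = .int (-1)) ∨ IsConnectedCount r m (Set.range (Fin.append x y)) t) :
    ∃ t' : Term L P, IsBase r m ((l * nu (degree L A) ((2 * r + 1) * m)) ^ m)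
        (Set.range (Fin.append x y)) t' ∧
      IsReplacement (IsShift x y v w
        (ball L ((2 * r + 1) * (l + m)) fun ij : Fin s × Fin k => v ij.1 ij.2)) t t' := by
  obtain (rfl | rfl) | ht := ht
  · exact ⟨.int 0, .inl ⟨0, by simp, by positivity, rfl⟩, isReplacement_int 0⟩
  · exact ⟨.int (-1), .inl ⟨-1, le_rfl, by omega, rfl⟩, isReplacement_int (-1)⟩
  · exact ht.exists_isReplacement hxy v w

end Replacement

end FOC1

theorem lemma4p2 (L : FirstOrder.Language.{0, 0}) [L.IsRelational] [Finite (Σ n, L.Relations n)]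
    (P : FOC1.NumPredicates) (r k l m : ℕ) (hklm : 1 ≤ k + l + m)
    (x : Fin k → ℕ) (y : Fin l → ℕ) (z : Fin m ↪ ℕ)
    (hxyz : Function.Injective (Fin.append (Fin.append x y) z))
    (φ : FOC1.Formula L P) (hφ : φ.IsFO)
    (hloc : FOC1.IsLocal r φ (Fin.append (Fin.append x y) z))
    (G : SimpleGraph (Fin (k + l + m)))
    (uG : FOC1.Term L P)
    (huG : uG = .count z (.and φ (.delta G (2 * r + 1) (Fin.append (Fin.append x y) z)))) :
    ∃ q : ℕ, ∀ (A : Type) [Finite A] [L.Structure A] (s : ℕ), 1 ≤ s →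
      ∀ (v : Fin s → Fin k → A) (w : Fin l → A),
      ∃ u' : FOC1.Term L P,
        u'.InFOC1 (k + l) q ∧
        (u'.free : Set ℕ) ⊆ Set.range (Fin.append x y) ∧
        (∀ w' : Fin l → A,
          FOC1.AgreeOn
            (FOC1.ball L ((2 * r + 1) * (l + m)) (fun ij : Fin s × Fin k => v ij.1 ij.2)) w w' →
          ∀ (i : Fin s) (β β' : ℕ → A),
            (∀ j, β (Fin.append x y j) = Fin.append (v i) w j) →
            (∀ j, β' (Fin.append x y j) = Fin.append (v i) w' j) →
            uG.eval β = u'.eval β') ∧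
        FOC1.IsCombination
          (fun t =>
            (∃ i : ℤ, -1 ≤ i ∧ i ≤ (((l * FOC1.nu (FOC1.degree L A) ((2 * r + 1) * m)) ^ m : ℕ) : ℤ) ∧
              t = .int i) ∨
            FOC1.IsConnectedCount r m (Set.range (Fin.append x y)) t)
          u' := by
  subst huG
  have hxy : Function.Injective (Fin.append x y) := (Fin.append_injective_iff.1 hxyz).1
  obtain ⟨t, ht, heq⟩ := FOC1.exists_isCombination_quantity_eq hklm hxyz hφ hloc G
  refine ⟨t.size, fun A _ _ s _ v w => ?_⟩
  obtain ⟨u', hu', hsize, heval⟩ :=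
    ht.exists_isReplacement fun t ht => FOC1.exists_isBase_isReplacement hxy v w ht
  have hfree := hu'.free_subset fun t ht => ht.free_subset
  refine ⟨u', ⟨hu'.isFOC1 fun t ht => ht.isFOC1, ?_, hsize⟩, hfree, ?_, hu'⟩
  · have hsub : u'.free ⊆ Finset.univ.image (Fin.append x y) :=
      Finset.coe_subset.1 (hfree.trans (by simp))
    exact (Finset.card_le_card hsub).trans (Finset.card_image_le.trans (by simp))
  · intro w' hw' i β β' hβ hβ'
    exact (congrFun (congrFun heq ⟨A⟩) β).trans (heval β β' ⟨i, w', hw', hβ, hβ'⟩)
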